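/- Let $N\ge 0$ be an integer, let $a\neq 0$, $\gamma>0$, $\beta\ge 0$ be real, let $b\in\mathbb R$ with $b\ne k\pi$ for all $k\in\mathbb Z$, and for $i=1,\dots,N$ let $0<\varphi_i<\pi$ and $a_i\in\mathbb R$. Put $c=\frac{a\gamma}{2}\frac{\sin b}{\cos b-1}$, $\theta_n=bn+\frac c2 s$ and $$Z_{i,n}=\frac n2\ln r_i-\frac\beta4\sin(\varphi_i)\,s+a_i,\qquad r_i=\frac{a\gamma+2\beta\sin(\frac b2)\cos(\frac b2+\varphi_i)}{a\gamma+2\beta\sin(\frac b2)\cos(\frac b2-\varphi_i)},$$ and assume $r_i>0$ for all $i$. Let $G_n=(g_{ij})$, $H_n=(h_{ij})$ be the $N\times N$ matrices $$g_{ij}=\frac{\delta_{ij}+e^{Z_{i,n}+Z_{j,n}}}{e^{-\mathrm i\varphi_i}-e^{\mathrm i\varphi_j}},\qquad h_{ij}=\frac{\delta_{ij}+e^{(Z_{i,n}-\mathrm i\varphi_i)+(Z_{j,n}-\mathrm i\varphi_j)}}{e^{-\mathrm i\varphi_i}-e^{\mathrm i\varphi_j}}.$$ (1) For all $n\in\mathbb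 Z$, $s\in\mathbb R$ one has $\det G_n\ne0$, and $$\rho_n=\frac\gamma2-\frac2a\,\partial_s\ln\frac{\det G_{n+1}}{\det G_n},\qquad q_n=\frac\beta2\,\frac{\det H_n}{\det G_n}\,e^{\mathrm i\theta_n},\qquad x_n=\frac{\gamma}{2}an+\frac{\beta^2}{8}s-2\,\partial_s\ln\det G_n$$ define differentiable functions of $s$ with $\rho_n,x_n$ real, $a\rho_n=x_{n+1}-x_n$ and $\partial_s x_n=\frac12|q_n|^2$. They solve the defocusing semi-discrete complex short pulse equation in its coupled form, $$\partial_s(q_{n+1}-q_n)=\tfrac12(x_{n+1}-x_n)(q_{n+1}+q_n),\qquad \partial_s(x_{n+1}-x_n)-\tfrac12\left(|q_{n+1}|^2-|q_n|^2\right)=0 .$$ Moreover, with $t=-s$, $\Delta x_n=x_{n+1}-x_n$ and $D_n=(q_{n+1}-q_n)/\Delta x_n$, wherever $\Delta x_n\,\Delta x_{n+1}\neq0$, $$\delta_tD_n+\tfrac12(q_{n+1}+q_n)-\frac{1}{2\Delta x_n}\left(|q_{n+1}|^2D_{n+1}-|q_n|^2D_n\right)=0,$$ where $\delta_tD_n=\frac{dD_n}{dt}-\frac{dx_{n+1}}{dt}\,\frac{D_{n+1}-D_n}{\Delta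 x_n}$ is the (discretized) time derivative at a fixed position. (2) Suppose in addition that $\beta>0$ and that the $\varphi_i$ are pairwise distinct. Then this solution is the limit $\lambda_i\to\bar\lambda_i$ of the $N$-fold Darboux transformation of the plane-wave seed $q_n^{[0]}=\frac\beta2e^{\mathrm i\theta_n}$, $\rho_n^{[0]}=\frac\gamma2$, $x_n^{[0]}=\frac\gamma2an+\frac{\beta^2}8s$. Precisely, take $\alpha_i\in\mathbb C$ with $\operatorname{Im}\left(\alpha_i(1-e^{2\mathrm i\varphi_i})\right)=\frac1{2\beta\sin\varphi_i}$, and for $\lambda_i\notin\mathbb R$ and $\xi_i$ with $\xi_i^2=(\lambda_i+c)^2-\beta^2$ let $$y_{i,n}=\begin{bmatrix}e^{-\frac{\mathrm i}2\theta_n}&0\\0&e^{\frac{\mathrm i}2\theta_n}\end{bmatrix}\begin{bmatrix}1&1\\ \frac{\beta}{c+\lambda_i+\xi_i}&\frac{\beta}{c+\lambda_i-\xi_i}\end{bmatrix}\begin{bmatrix}e^{\omega_{i,n}}\\ \alpha_i(\bar\lambda_i-\lambda_i)e^{-\omega_{i,n}}\end{bmatrix},$$ $$\omega_{i,n}=\frac{\mathrm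 i}{4}\xi_is+\frac n2\ln\frac{\sin(\frac b2)(\frac{\mathrm i}2a\gamma-\xi_i)+\mathrm i\cos(\frac b2)\lambda_i}{\sin(\frac b2)(\frac{\mathrm i}2a\gamma+\xi_i)+\mathrm i\cos(\frac b2)\lambda_i}+a_i .$$ Let all $(\lambda_i,\xi_i)$ tend simultaneously to $(\beta\cos\varphi_i-c,\ \mathrm i\beta\sin\varphi_i)$; such a limit exists, that is, there are admissible pairs $(\lambda_i,\xi_i)$ arbitrarily close to these points. Once the $(\lambda_i,\xi_i)$ are close enough to their limits, $y_{i,n}$ is, up to a non-zero factor depending only on $n$ (and on the parameters), a solution with $(q,\rho,\lambda)=(q^{[0]},\rho^{[0]},\lambda_i)$ of the Lax pair $\Psi_{n+1}=U_n\Psi_n$, $\partial_s\Psi_n=V_n\Psi_n$, $$U_n=\begin{bmatrix}1-\frac{\mathrm ia\rho_n}\lambda&\frac{\bar q_{n+1}-\bar q_n}{\lambda}\\ \frac{q_{n+1}-q_n}\lambda&1+\frac{\mathrm ia\rho_n}{\lambda}\end{bmatrix},\qquad V_n=\begin{bmatrix}\frac{\mathrm i}4\lambda&-\frac{\mathrm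 i}2\bar q_n\\ \frac{\mathrm i}2q_n&-\frac{\mathrm i}4\lambda\end{bmatrix}.$$ With $M_n=\left(\frac{y_{i,n}^\dagger\,\mathrm{diag}(1,-1)\,y_{j,n}}{\bar\lambda_i-\lambda_j}\right)_{i,j}$ and $Y_{k,n}$ the row of the $k$-th components of $y_{1,n},\dots,y_{N,n}$, for every $n$ and $s$ eventually $\det M_n\neq0$, and $$q_n^{[0]}+\frac{1}{\det M_n}\det\begin{bmatrix}M_n&Y_{1,n}^\dagger\\-Y_{2,n}&0\end{bmatrix}\to q_n,\qquad \rho_n^{[0]}-\frac2a\,\partial_s\ln\frac{\det M_{n+1}}{\det M_n}\to\rho_n,\qquad x_n^{[0]}-2\,\partial_s\ln\det M_n\to x_n .$$ -/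

import Mathlib

open scoped Matrix

noncomputable section

namespace SemiDiscreteCSP

/-! ### The semi-discrete complex short pulse equation

The lattice index is `n : ℤ`, and `s = -t` is the evolution variable of the Lax pair. -/

/-- Coupled form of the semi-discrete complex short pulse equation in the variable `s`
(`σ = 1` focusing, `σ = -1` defocusing):
`d/ds (q_{n+1} - q_n) = (1/2) (x_{n+1} - x_n) (q_{n+1} + q_n)` and
`d/ds (x_{n+1} - x_n) + (σ/2) (|q_{n+1}|² - |q_n|²) = 0`. -/
def IsCoupledSolution (σ : ℝ) (q : ℤ → ℝ → ℂ) (x : ℤ → ℝ → ℝ) : Prop :=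
  (∀ n, Differentiable ℝ (q n)) ∧ (∀ n, Differentiable ℝ (x n)) ∧
  ∀ n s,
    deriv (fun u => q (n + 1) u - q n u) s
        = (1 / 2 : ℂ) * ((x (n + 1) s - x n s : ℝ) : ℂ) * (q (n + 1) s + q n s) ∧
    deriv (fun u => x (n + 1) u - x n u) s
        + σ / 2 * (‖q (n + 1) s‖ ^ 2 - ‖q n s‖ ^ 2) = 0

/-- The difference quotient `(q_{n+1} - q_n) / Δx_n`. -/
def slope (q : ℤ → ℝ → ℂ) (x : ℤ → ℝ → ℝ) (n : ℤ) (t : ℝ) : ℂ :=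
  (q (n + 1) t - q n t) / ((x (n + 1) t - x n t : ℝ) : ℂ)

/-- Time derivative of the lattice function `F` at a fixed position: the derivative along the
moving node minus the (forward-differenced) convective term
`(dx_{n+1}/dt) (F_{n+1} - F_n) / Δx_n`. -/
def fixedPositionDeriv (x : ℤ → ℝ → ℝ) (F : ℤ → ℝ → ℂ) (n : ℤ) (t : ℝ) : ℂ :=
  deriv (F n) t
    - ((deriv (x (n + 1)) t : ℝ) : ℂ) * (F (n + 1) t - F n t)
        / ((x (n + 1) t - x n t : ℝ) : ℂ)

/-- The semi-discrete complex short pulse equation as a single equation in the time `t`, imposed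
wherever the two mesh widths that occur in it do not vanish:
`∂_t (δq_n/Δx_n) + (1/2)(q_{n+1}+q_n)
  + (σ/2) (1/Δx_n) (|q_{n+1}|² δq_{n+1}/Δx_{n+1} - |q_n|² δq_n/Δx_n) = 0`. -/
def SatisfiesScalarEquation (σ : ℝ) (q : ℤ → ℝ → ℂ) (x : ℤ → ℝ → ℝ) : Prop :=
  ∀ n t, x (n + 1) t - x n t ≠ 0 → x (n + 2) t - x (n + 1) t ≠ 0 →
    fixedPositionDeriv x (slope q x) n t + (1 / 2 : ℂ) * (q (n + 1) t + q n t)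
      + (σ : ℂ) / 2 * (1 / ((x (n + 1) t - x n t : ℝ) : ℂ))
        * ((‖q (n + 1) t‖ : ℂ) ^ 2 * slope q x (n + 1) t - (‖q n t‖ : ℂ) ^ 2 * slope q x n t) = 0

/-! ### Lax pair and N-fold Darboux transformation -/

/-- The spatial Lax matrix `U_n`. -/
def laxU (σ a : ℝ) (q : ℤ → ℝ → ℂ) (ρ : ℤ → ℝ → ℝ) (lam : ℂ) (n : ℤ) (s : ℝ) :
    Matrix (Fin 2) (Fin 2) ℂ :=
  !![1 - Complex.I * a * ρ n s / lam, -σ * (star (q (n + 1) s) - star (q n s)) / lam;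
     (q (n + 1) s - q n s) / lam, 1 + Complex.I * a * ρ n s / lam]

/-- The temporal Lax matrix `V_n`. -/
def laxV (σ : ℝ) (q : ℤ → ℝ → ℂ) (lam : ℂ) (n : ℤ) (s : ℝ) : Matrix (Fin 2) (Fin 2) ℂ :=
  !![Complex.I / 4 * lam, Complex.I / 2 * (σ * star (q n s));
     Complex.I / 2 * q n s, -(Complex.I / 4 * lam)]

/-- `y` solves `y_{n+1} = U_n y_n`, `∂_s y_n = V_n y_n` at the spectral parameter `lam`. -/
def IsLaxSolution (σ a : ℝ) (q : ℤ → ℝ → ℂ) (ρ : ℤ → ℝ → ℝ) (lam : ℂ)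
    (y : ℤ → ℝ → Fin 2 → ℂ) : Prop :=
  ∀ n s, y (n + 1) s = laxU σ a q ρ lam n s *ᵥ y n s ∧
    HasDerivAt (y n) (laxV σ q lam n s *ᵥ y n s) s

/-- `M_n = (⟨y_i|J|y_j⟩ / (conj λ_i - λ_j))` with `J = diag(1, σ)`. -/
def dtM {N : ℕ} (σ : ℝ) (lam : Fin N → ℂ) (y : Fin N → ℤ → ℝ → Fin 2 → ℂ) (n : ℤ) (s : ℝ) :
    Matrix (Fin N) (Fin N) ℂ :=
  Matrix.of fun i j =>
    (star (y i n s) ⬝ᵥ (Matrix.diagonal ![1, (σ : ℂ)] *ᵥ y j n s)) / (star (lam i) - lam j)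

/-- The bordered matrix with blocks `M_n`, `Y_1†`, `-Y_2`, `0`, where `Y_k` is the row of
`k`-th components of the vectors `y_j`. -/
def dtBordered {N : ℕ} (σ : ℝ) (lam : Fin N → ℂ) (y : Fin N → ℤ → ℝ → Fin 2 → ℂ)
    (n : ℤ) (s : ℝ) : Matrix (Fin N ⊕ Unit) (Fin N ⊕ Unit) ℂ :=
  Matrix.fromBlocks (dtM σ lam y n s) (Matrix.of fun i _ => star (y i n s 0))
    (Matrix.of fun _ j => -(y j n s 1)) 0

/-- Transformed field: `q_n + det(bordered matrix) / det M_n`. -/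
def dtQ {N : ℕ} (σ : ℝ) (q : ℤ → ℝ → ℂ) (lam : Fin N → ℂ) (y : Fin N → ℤ → ℝ → Fin 2 → ℂ)
    (n : ℤ) (s : ℝ) : ℂ :=
  q n s + (dtBordered σ lam y n s).det / (dtM σ lam y n s).det

/-- Transformed density: `ρ_n - (2/a) ∂_s ln (det M_{n+1} / det M_n)`. -/
def dtRho {N : ℕ} (σ a : ℝ) (ρ : ℤ → ℝ → ℝ) (lam : Fin N → ℂ)
    (y : Fin N → ℤ → ℝ → Fin 2 → ℂ) (n : ℤ) (s : ℝ) : ℂ :=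
  ρ n s - 2 / a * logDeriv (fun u => (dtM σ lam y (n + 1) u).det / (dtM σ lam y n u).det) s

/-- Transformed coordinate: `x_n - 2 ∂_s ln det M_n`. -/
def dtX {N : ℕ} (σ : ℝ) (x : ℤ → ℝ → ℝ) (lam : Fin N → ℂ)
    (y : Fin N → ℤ → ℝ → Fin 2 → ℂ) (n : ℤ) (s : ℝ) : ℂ :=
  x n s - 2 * logDeriv (fun u => (dtM σ lam y n u).det) s

/-! ### The plane-wave seed and its eigenfunctions -/

/-- `c = (aγ/2) sin b / (cos b - 1)`. -/
def seedC (a b γ : ℝ) : ℝ := a * γ / 2 * (Real.sin b / (Real.cos b - 1))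

/-- `θ_n = b n + (c/2) s`. -/
def theta (a b γ : ℝ) (n : ℤ) (s : ℝ) : ℝ := b * n + seedC a b γ / 2 * s

/-- `q_n^{[0]} = (β/2) e^{iθ_n}`. -/
def seedQ (a b β γ : ℝ) (n : ℤ) (s : ℝ) : ℂ :=
  (β : ℂ) / 2 * Complex.exp (Complex.I * theta a b γ n s)

/-- `ρ_n^{[0]} = γ/2`. -/
def seedRho (γ : ℝ) (_n : ℤ) (_s : ℝ) : ℝ := γ / 2

/-- `x_n^{[0]} = (γ/2) a n + (β²/8) s`. -/
def seedX (a β γ : ℝ) (n : ℤ) (s : ℝ) : ℝ := γ / 2 * a * n + β ^ 2 / 8 * s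

/-- The spectral curve `ξ² = (λ + c)² - β²` over non-real `λ`; its points are pairs `(λ, ξ)`. -/
def spectralCurve (a b β γ : ℝ) : Set (ℂ × ℂ) :=
  {p | p.2 ^ 2 = (p.1 + seedC a b γ) ^ 2 - (β : ℂ) ^ 2 ∧ p.1.im ≠ 0}

/-- The point `λ = β cos φ - c`, `ξ = iβ sin φ` with real `λ`, i.e. `c + λ ± ξ = β e^{± iφ}`. -/
def realPoint (a b β γ φ : ℝ) : ℂ × ℂ :=
  ((β * Real.cos φ - seedC a b γ : ℝ), Complex.I * ((β * Real.sin φ : ℝ) : ℂ))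

/-- The limit `λ_i → conj λ_i`: all points `(λ_i, ξ_i)` of the spectral curve over non-real
`λ_i` tend simultaneously to the points with real `λ_i = β cos φ_i - c`. -/
def toRealAxis {N : ℕ} (a b β γ : ℝ) (φ : Fin N → ℝ) : Filter (Fin N → ℂ × ℂ) :=
  nhdsWithin (fun i => realPoint a b β γ (φ i)) {p | ∀ i, p i ∈ spectralCurve a b β γ}

/-- The phase `ω_n` at the point `p = (λ, ξ)`, with additive real parameter `κ`. -/
def omega (a b γ κ : ℝ) (p : ℂ × ℂ) (n : ℤ) (s : ℝ) : ℂ :=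
  Complex.I / 4 * p.2 * s
    + (n : ℂ) / 2 * Complex.log
        ((Real.sin (b / 2) * (Complex.I * a * γ / 2 - p.2) + Complex.I * Real.cos (b / 2) * p.1)
          / (Real.sin (b / 2) * (Complex.I * a * γ / 2 + p.2)
              + Complex.I * Real.cos (b / 2) * p.1))
    + κ

/-- The vector `K L E` at the point `p = (λ, ξ)`; up to a factor depending on `n` only it is the
general eigenfunction of the seed. -/
def eigenvector (a b β γ κ : ℝ) (α : ℂ) (p : ℂ × ℂ) (n : ℤ) (s : ℝ) : Fin 2 → ℂ :=
  (Matrix.diagonal ![Complex.exp (-(Complex.I / 2 * theta a b γ n s)),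
      Complex.exp (Complex.I / 2 * theta a b γ n s)]
    * !![1, 1; β / (seedC a b γ + (p.1 + p.2)), β / (seedC a b γ + (p.1 - p.2))])
    *ᵥ ![Complex.exp (omega a b γ κ p n s),
      α * (star p.1 - p.1) * Complex.exp (-omega a b γ κ p n s)]

/-! ### The N-dark soliton formulas -/

/-- The argument of the logarithm in `Z_n`. -/
def growthRatio (a b β γ φ : ℝ) : ℝ :=
  (a * γ + 2 * β * Real.sin (b / 2) * Real.cos (b / 2 + φ))
    / (a * γ + 2 * β * Real.sin (b / 2) * Real.cos (b / 2 - φ))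

/-- `Z_n(φ, κ) = (n/2) ln (growth ratio) - (β/4) sin φ · s + κ`. -/
def Z (a b β γ φ κ : ℝ) (n : ℤ) (s : ℝ) : ℝ :=
  (n : ℝ) / 2 * Real.log (growthRatio a b β γ φ) - β / 4 * Real.sin φ * s + κ

/-- `G_n`, with entries `(δ_ij + e^{Z_i + Z_j}) / (e^{-iφ_i} - e^{iφ_j})`. -/
def darkG {N : ℕ} (a b β γ : ℝ) (φ κ : Fin N → ℝ) (n : ℤ) (s : ℝ) :
    Matrix (Fin N) (Fin N) ℂ :=
  Matrix.of fun i j =>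
    ((if i = j then 1 else 0)
        + Complex.exp (Z a b β γ (φ i) (κ i) n s + Z a b β γ (φ j) (κ j) n s))
      / (Complex.exp (-(Complex.I * φ i)) - Complex.exp (Complex.I * φ j))

/-- `H_n`, with entries
`(δ_ij + e^{(Z_i - iφ_i) + (Z_j - iφ_j)}) / (e^{-iφ_i} - e^{iφ_j})`. -/
def darkH {N : ℕ} (a b β γ : ℝ) (φ κ : Fin N → ℝ) (n : ℤ) (s : ℝ) :
    Matrix (Fin N) (Fin N) ℂ :=
  Matrix.of fun i j =>
    ((if i = j then 1 else 0)
        + Complex.exp ((Z a b β γ (φ i) (κ i) n s - Complex.I * φ i)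
            + (Z a b β γ (φ j) (κ j) n s - Complex.I * φ j)))
      / (Complex.exp (-(Complex.I * φ i)) - Complex.exp (Complex.I * φ j))

/-- `q_n = (β/2) (det H_n / det G_n) e^{iθ_n}`. -/
def darkQ {N : ℕ} (a b β γ : ℝ) (φ κ : Fin N → ℝ) (n : ℤ) (s : ℝ) : ℂ :=
  (β : ℂ) / 2 * ((darkH a b β γ φ κ n s).det / (darkG a b β γ φ κ n s).det)
    * Complex.exp (Complex.I * theta a b γ n s)

end SemiDiscreteCSP

end

noncomputable section

namespace SemiDiscreteCSP

/-! The solution is obtained by dressing the plane wave directly at real spectral parameters. Write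
`λ U_n = λ + A` and `V_n = λ j + Q` with `j = (i/4) J`, `J = diag(1, -1)`. Let the columns of `Y` be
seed eigenvectors at `λ_i = β cos φ_i - c`, let `Λ = diag(λ_i)`, and normalize the shift by a real
diagonal `D` with `D² = Λ² + K`. The matrix `G` satisfies `ΛG - GΛ = (β/2) Y†JY` and `∂_s G =
-(i/4)(β/2) Y†Y`, together with a matching law for `n ↦ n + 1` (`darkL_commutator`,
`hasEntryDerivAt_darkG`, `darkG_shift`). With `W = (β/2) Y G⁻¹ Y†J` and `T = (β/2) Y G⁻¹ Λ Y†J`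
these relations give the evolution of `W` (`hasEntryDerivAt_dressing`) and its discrete analogue
(`dressed_shift`, `dressed_shift_second`). They combine algebraically (`dressed_zeroCurvature`) into
zero curvature for `A + W₁ - W` and `Q - [j, W]`, whose lower left entry is the equation for `q`.
The upper left entry of the evolution of `W` gives `∂_s x = |q|²/2`.

The determinant formulas reduce to `W`: `H` is a rank-one perturbation of `G`, so `det H / det G`
produces `W₁₀`, and Jacobi's formula turns `∂_s ln det G` into a multiple of `tr(Y G⁻¹ Y†)`, hence
of `W₀₀` since `tr W = 0`. Everything is regular because `G` is `i` times a positive definite matrix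
(`cauchy_form_nonneg`, `darkG_det_ne_zero`).

For the Darboux limit, the spectral curve is uniformized by `w = (c + λ + ξ)/β`, and `w_i →
e^{iφ_i}`. Then `M → (2/β) G` entrywise: off the diagonal by continuity, on the diagonal as a `0/0`
limit in which the coefficient `α_i (conj λ_i - λ_i)` leaves a finite contribution, and the
condition on `α_i` makes it the `δ_ij` term (`tendsto_diagonal_form`). Since `∂_s M` is a quadratic
expression in the eigenvectors, logarithmic derivatives of determinants converge as well. -/

/-! ### Entrywise derivatives of matrix-valued functions -/

/-- Every entry of the matrix function `F` has the corresponding entry of `F'` as derivative. -/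
def HasEntryDerivAt {m n : Type*} (F : ℝ → Matrix m n ℂ) (F' : Matrix m n ℂ) (s : ℝ) : Prop :=
  ∀ i j, HasDerivAt (fun u => F u i j) (F' i j) s

section EntryDeriv

variable {l m n : Type*} {F : ℝ → Matrix l m ℂ} {F' : Matrix l m ℂ} {s : ℝ}

theorem HasEntryDerivAt.mul [Fintype m] {H : ℝ → Matrix m n ℂ} {H' : Matrix m n ℂ}
    (hF : HasEntryDerivAt F F' s) (hH : HasEntryDerivAt H H' s) :
    HasEntryDerivAt (fun u => F u * H u) (F' * H s + F s * H') s := by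
  intro i j
  simp only [Matrix.mul_apply, Matrix.add_apply, ← Finset.sum_add_distrib]
  exact HasDerivAt.fun_sum fun k _ => (hF i k).mul (hH k j)

theorem HasEntryDerivAt.conjTranspose (hF : HasEntryDerivAt F F' s) :
    HasEntryDerivAt (fun u => (F u)ᴴ) F'ᴴ s := by
  intro i j
  simpa only [Matrix.conjTranspose_apply] using (hF j i).star

theorem HasEntryDerivAt.mul_const [Fintype m] (C : Matrix m n ℂ) (hF : HasEntryDerivAt F F' s) :
    HasEntryDerivAt (fun u => F u * C) (F' * C) s := by
  intro i j
  simp only [Matrix.mul_apply]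
  exact HasDerivAt.fun_sum fun k _ => (hF i k).mul_const _

theorem HasEntryDerivAt.const_smul (c : ℂ) (hF : HasEntryDerivAt F F' s) :
    HasEntryDerivAt (fun u => c • F u) (c • F') s := by
  intro i j
  simpa using (hF i j).const_mul c

theorem HasEntryDerivAt.congr_deriv {F'' : Matrix l m ℂ} (hF : HasEntryDerivAt F F' s)
    (h : F' = F'') : HasEntryDerivAt F F'' s := h ▸ hF

variable [Fintype n] [DecidableEq n] {M : ℝ → Matrix n n ℂ} {M' : Matrix n n ℂ}

/-- Jacobi's formula for the derivative of a determinant. -/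
theorem HasEntryDerivAt.det (hM : HasEntryDerivAt M M' s) :
    HasDerivAt (fun u => (M u).det) ((M s).adjugate * M').trace s := by
  have h1 : HasDerivAt (fun u => (M u).det)
      (∑ σ : Equiv.Perm n, ((Equiv.Perm.sign σ : ℤ) : ℂ) *
        ∑ i, (∏ j ∈ Finset.univ.erase i, M s (σ j) j) * M' (σ i) i) s := by
    simp only [Matrix.det_apply']
    refine HasDerivAt.fun_sum fun σ _ => HasDerivAt.const_mul _ ?_
    simpa only [smul_eq_mul] using
      HasDerivAt.fun_finsetProd (u := Finset.univ) fun i _ => hM (σ i) i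
  convert h1 using 1
  -- By Cramer's rule a diagonal entry of `adj(M) M'` is the determinant of `M` with one column
  -- replaced by that of `M'`.
  have h2 : ∀ i, ((M s).adjugate * M') i i = ((M s).updateCol i (fun r => M' r i)).det := by
    intro i
    rw [← Matrix.cramer_apply, Matrix.cramer_eq_adjugate_mulVec]
    rfl
  simp only [Matrix.trace, Matrix.diag_apply, h2, Matrix.det_apply', Finset.mul_sum]
  rw [Finset.sum_comm]
  refine Finset.sum_congr rfl fun σ _ => Finset.sum_congr rfl fun i _ => ?_
  rw [← Finset.mul_prod_erase Finset.univ _ (Finset.mem_univ i)]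
  rw [Matrix.updateCol_self, mul_comm (M' _ _)]
  congr 2
  refine Finset.prod_congr rfl fun j hj => ?_
  rw [Matrix.updateCol_ne (Finset.ne_of_mem_erase hj)]

theorem HasEntryDerivAt.logDeriv_det (hM : HasEntryDerivAt M M' s) :
    logDeriv (fun u => (M u).det) s = ((M s).adjugate * M').trace / (M s).det := by
  rw [logDeriv_apply, hM.det.deriv]

theorem HasEntryDerivAt.logDeriv_det_eq_trace_inv (hM : HasEntryDerivAt M M' s) :
    logDeriv (fun u => (M u).det) s = ((M s)⁻¹ * M').trace := by
  rw [hM.logDeriv_det, Matrix.inv_def, Matrix.smul_mul, Matrix.trace_smul, Ring.inverse_eq_inv',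
    smul_eq_mul, div_eq_inv_mul]

theorem HasEntryDerivAt.inv (hM : HasEntryDerivAt M M' s) (hdet : ∀ u, (M u).det ≠ 0) :
    HasEntryDerivAt (fun u => (M u)⁻¹) (-((M s)⁻¹ * M' * (M s)⁻¹)) s := by
  -- Differentiability first: entries of the inverse are quotients of determinants. The value of the
  -- derivative is then forced by differentiating `M⁻¹ M = 1`.
  have hd : ∀ i j, ∃ d, HasDerivAt (fun u => (M u)⁻¹ i j) d s := by
    intro i j
    have hadj : HasEntryDerivAt (fun u => (M u).updateRow j (Pi.single i 1))
        (M'.updateRow j 0) s := by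
      intro p q
      by_cases hp : p = j
      · subst hp
        simp only [Matrix.updateRow_self, Pi.zero_apply]
        exact hasDerivAt_const s _
      · simpa only [Matrix.updateRow_ne hp] using hM p q
    have h := (hM.det.inv (hdet s)).mul hadj.det
    refine ⟨_, h.congr_of_eventuallyEq (Filter.Eventually.of_forall fun u => ?_)⟩
    simp only [Matrix.inv_def, Matrix.smul_apply, Matrix.adjugate_apply, Ring.inverse_eq_inv',
      smul_eq_mul, Pi.mul_apply, Pi.inv_apply]
  choose D hD using hd
  have hD' : HasEntryDerivAt (fun u => (M u)⁻¹) (Matrix.of D) s := hD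
  have hu : ∀ u, IsUnit (M u).det := fun u => (hdet u).isUnit
  have hprod : Matrix.of D * M s + (M s)⁻¹ * M' = 0 := by
    ext i j
    have h1 := (hD'.mul hM) i j
    simp only [Matrix.nonsing_inv_mul _ (hu _)] at h1
    exact h1.unique (hasDerivAt_const s _)
  refine hD'.congr_deriv ?_
  have h2 : Matrix.of D * M s = -((M s)⁻¹ * M') := eq_neg_of_add_eq_zero_left hprod
  rw [← Matrix.mul_nonsing_inv_cancel_right (A := M s) (Matrix.of D) (hu s), h2, Matrix.neg_mul]

end EntryDeriv

/-! ### Determinants -/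

theorem det_bordered {n : Type*} [Fintype n] [DecidableEq n] (M : Matrix n n ℂ)
    (B : Matrix n Unit ℂ) (C : Matrix Unit n ℂ) (hM : M.det ≠ 0) :
    (Matrix.fromBlocks M B C 0).det = -(M.det * (C * M⁻¹ * B) () ()) := by
  have := Matrix.invertibleOfIsUnitDet M hM.isUnit
  rw [Matrix.det_fromBlocks₁₁, Matrix.det_unique (n := Unit), Matrix.invOf_eq_nonsing_inv]
  simp

theorem det_add_mul_eq {n : Type*} [Fintype n] [DecidableEq n] (M : Matrix n n ℂ)
    (B : Matrix n Unit ℂ) (C : Matrix Unit n ℂ) (hM : M.det ≠ 0) :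
    (M + B * C).det = M.det * (1 + (C * M⁻¹ * B) () ()) := by
  rw [Matrix.det_add_mul _ _ hM.isUnit, Matrix.det_unique (n := Unit)]
  simp

/-! ### Positivity of the Cauchy matrix of points of the upper half-plane -/

/-- The kernel is a Gram kernel: `1 / (conj w_i - w_j) = i ∫₀^∞ exp(i (w_j - conj w_i) x) dx`,
convergent because both points lie in the upper half-plane. The form is therefore `i` times the
squared `L²` norm of a sum of decaying exponentials. -/
theorem cauchy_form_nonneg {ι : Type*} [Fintype ι] (w : ι → ℂ) (hw : ∀ i, 0 < (w i).im)
    (v : ι → ℂ) :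
    ∃ r : ℝ, 0 ≤ r ∧
      ∑ i, ∑ j, star (v i) * v j / (star (w i) - w j) = Complex.I * (r : ℂ) := by
  have hre : ∀ i j, (Complex.I * (w j - star (w i))).re < 0 := by
    intro i j
    have h1 := hw i
    have h2 := hw j
    simp
    linarith
  set f : ℝ → ℂ := fun x => ∑ i, v i * Complex.exp (Complex.I * w i * x) with hf
  refine ⟨∫ x in Set.Ioi (0 : ℝ), ‖f x‖ ^ 2, MeasureTheory.integral_nonneg fun x => by positivity, ?_⟩
  have hexp : ∀ x : ℝ, ((‖f x‖ ^ 2 : ℝ) : ℂ)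
      = ∑ i, ∑ j, star (v i) * v j * Complex.exp (Complex.I * (w j - star (w i)) * x) := by
    intro x
    have h1 : ((‖f x‖ ^ 2 : ℝ) : ℂ) = star (f x) * f x := by
      rw [Complex.star_def, ← Complex.normSq_eq_conj_mul_self, Complex.normSq_eq_norm_sq]
    rw [h1, hf]
    simp only [star_sum, Finset.sum_mul_sum]
    refine Finset.sum_congr rfl fun i _ => Finset.sum_congr rfl fun j _ => ?_
    have h2 : star (Complex.exp (Complex.I * w i * x))
        = Complex.exp (-(Complex.I * star (w i) * x)) := by
      rw [Complex.star_def, ← Complex.exp_conj]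
      simp
    rw [star_mul', h2]
    rw [show Complex.I * (w j - star (w i)) * x
      = -(Complex.I * star (w i) * x) + Complex.I * w j * x by ring, Complex.exp_add]
    ring
  rw [← integral_complex_ofReal]
  simp only [hexp]
  have hint : ∀ i j, MeasureTheory.IntegrableOn (fun x : ℝ => star (v i) * v j *
      Complex.exp (Complex.I * (w j - star (w i)) * x)) (Set.Ioi 0) := fun i j =>
    (integrableOn_exp_mul_complex_Ioi (hre i j) 0).const_mul _
  rw [MeasureTheory.integral_finsetSum _ fun i _ =>
    MeasureTheory.integrable_finsetSum _ fun j _ => hint i j, Finset.mul_sum]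
  refine Finset.sum_congr rfl fun i _ => ?_
  rw [MeasureTheory.integral_finsetSum _ fun j _ => hint i j, Finset.mul_sum]
  refine Finset.sum_congr rfl fun j _ => ?_
  rw [MeasureTheory.integral_const_mul, integral_exp_mul_complex_Ioi (hre i j)]
  have hne : w j - star (w i) ≠ 0 := by
    intro h
    have h1 := hre i j
    rw [h] at h1
    simp at h1
  have hne' : star (w i) - w j ≠ 0 := fun h => hne (by rw [← neg_sub, h, neg_zero])
  simp only [Complex.ofReal_zero, mul_zero, Complex.exp_zero]
  field_simp
  ring

/-! ### Algebra of the dressing matrices -/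

section Dressing

variable {m n : Type*} [Fintype m] [Fintype n] [DecidableEq n]

/-- The discrete dressing relations. If `G` solves `ΛG - GΛ = k Y†JY` and the shifted data satisfy
`Y₁ D = YΛ + AY` and `D G₁ D = ΛGΛ + KG + k Y†JAY`, then the dressed potential
`A + W₁ - W`, `W = k Y G⁻¹ Y† J`, acts on `Y G⁻¹` as a Lax matrix. -/
theorem dressed_shift {G G₁ L D D' : Matrix n n ℂ} {Y Y₁ : Matrix m n ℂ} {Z Z₁ : Matrix n m ℂ}
    {A J : Matrix m m ℂ} {k K : ℂ} (hG : IsUnit G.det) (hG₁ : IsUnit G₁.det)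
    (hD : D * D' = 1)
    (hLG : L * G - G * L = k • (Z * J * Y))
    (hY : Y₁ * D = Y * L + A * Y)
    (hZ : D * Z₁ * J = L * Z * J - Z * J * A)
    (hDD : D * D = L * L + K • 1)
    (hGD : D * G₁ * D = L * G * L + K • G + k • (Z * J * A * Y)) :
    Y₁ * G₁⁻¹ * D = Y * G⁻¹ * L + (A + k • (Y₁ * G₁⁻¹ * Z₁ * J) - k • (Y * G⁻¹ * Z * J)) *
      (Y * G⁻¹) := by
  have hD'D : D' * D = 1 := mul_eq_one_comm.mp hD
  set B := Y₁ * G₁⁻¹ with hB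
  -- The shift law is only known for `D G₁ D`, so `Y₁ G₁⁻¹` is tested against that product; it
  -- collapses to `Y₁ D`.
  have h1 : B * D' * (D * G₁ * D) = Y * L + A * Y := by
    rw [← hY, hB, ← Matrix.mul_assoc, ← Matrix.mul_assoc, Matrix.mul_assoc _ D' D, hD'D,
      Matrix.mul_one, Matrix.nonsing_inv_mul_cancel_right _ _ hG₁]
  have hGL : L * G * L = L * L * G - k • (L * Z * J * Y) := by
    have : G * L = L * G - k • (Z * J * Y) := by rw [← hLG]; abel
    rw [Matrix.mul_assoc, this, Matrix.mul_sub, Matrix.mul_smul]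
    simp only [Matrix.mul_assoc]
  have h2 : D * G₁ * D = D * D * G - k • (D * Z₁ * J * Y) := by
    rw [hGD, hGL, hZ, hDD, Matrix.add_mul, Matrix.sub_mul, smul_sub, Matrix.smul_mul,
      Matrix.one_mul]
    abel
  have h3 : B * D * G = k • (B * Z₁ * J * Y) + Y * L + A * Y := by
    rw [h2, Matrix.mul_sub, Matrix.mul_smul] at h1
    have e1 : B * D' * (D * D * G) = B * D * G := by
      rw [← Matrix.mul_assoc, ← Matrix.mul_assoc, Matrix.mul_assoc B D' D, hD'D, Matrix.mul_one]
    have e2 : B * D' * (D * Z₁ * J * Y) = B * Z₁ * J * Y := by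
      simp only [Matrix.mul_assoc]
      rw [← Matrix.mul_assoc D' D, hD'D, Matrix.one_mul]
    rw [e1, e2] at h1
    rw [add_assoc, ← h1]
    abel
  have h4 : B * D = k • (B * Z₁ * J * (Y * G⁻¹)) + Y * (L * G⁻¹) + A * (Y * G⁻¹) := by
    have h5 := congrArg (· * G⁻¹) h3
    simp only [Matrix.add_mul, Matrix.smul_mul] at h5
    rw [Matrix.mul_nonsing_inv_cancel_right _ _ hG] at h5
    rw [h5]
    simp only [Matrix.mul_assoc]
  -- The Sylvester relation conjugated by `G⁻¹`: the price of moving `Λ` past the inverse.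
  have h6 : L * G⁻¹ = G⁻¹ * L - k • (G⁻¹ * Z * J * (Y * G⁻¹)) := by
    have h7 := congrArg (fun X => G⁻¹ * X * G⁻¹) hLG
    simp only [Matrix.mul_sub, Matrix.sub_mul, Matrix.mul_smul, Matrix.smul_mul] at h7
    have e1 : G⁻¹ * (L * G) * G⁻¹ = G⁻¹ * L := by
      rw [← Matrix.mul_assoc, Matrix.mul_nonsing_inv_cancel_right _ _ hG]
    have e2 : G⁻¹ * (G * L) * G⁻¹ = L * G⁻¹ := by
      rw [Matrix.nonsing_inv_mul_cancel_left _ _ hG]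
    rw [e1, e2] at h7
    have e3 : G⁻¹ * (Z * J * Y) * G⁻¹ = G⁻¹ * Z * J * (Y * G⁻¹) := by
      simp only [Matrix.mul_assoc]
    rw [e3] at h7
    rw [← h7]
    abel
  rw [h4, h6]
  simp only [Matrix.mul_sub, Matrix.add_mul, Matrix.sub_mul, Matrix.mul_smul, Matrix.smul_mul,
    Matrix.mul_assoc]
  abel

variable [DecidableEq m]

/-- The next coefficient of the discrete dressing relation. -/
theorem dressed_shift_second {G G₁ L D D' : Matrix n n ℂ} {Y Y₁ : Matrix m n ℂ}
    {Z Z₁ : Matrix n m ℂ} {A A' J : Matrix m m ℂ} {k K : ℂ}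
    (hD : D * D' = 1) (hDL : D * L = L * D)
    (hZ : D * Z₁ * J = L * Z * J - Z * J * A)
    (hDD : D * D = L * L + K • 1) (hA : A * A = -(K • 1))
    (hB : Y₁ * G₁⁻¹ * D = Y * G⁻¹ * L + A' * (Y * G⁻¹)) :
    k • (Y₁ * G₁⁻¹ * L * Z₁ * J) + k • (Y₁ * G₁⁻¹ * Z₁ * J) * A
      = k • (Y * G⁻¹ * L * Z * J) + A' * (k • (Y * G⁻¹ * Z * J)) := by
  have hD'D : D' * D = 1 := mul_eq_one_comm.mp hD
  have hD'L : D' * L = L * D' := by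
    calc D' * L = D' * L * (D * D') := by rw [hD, Matrix.mul_one]
      _ = D' * (L * D) * D' := by simp only [Matrix.mul_assoc]
      _ = L * D' := by rw [← hDL, ← Matrix.mul_assoc, hD'D, Matrix.one_mul]
  have hZJ : Z₁ * J = D' * (L * Z * J - Z * J * A) := by
    rw [← hZ, ← Matrix.mul_assoc, ← Matrix.mul_assoc, hD'D, Matrix.one_mul]
  -- This inverts `hZ`. As `A² = -K`, one has `(Λ - A)(Λ + A) = Λ² + K = D²` in the sense of left
  -- multiplication by `Λ` and right multiplication by `A`.
  have hZA : L * (Z₁ * J) + Z₁ * J * A = D * (Z * J) := by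
    rw [hZJ]
    have e1 : L * (D' * (L * Z * J - Z * J * A)) = D' * (L * (L * Z * J - Z * J * A)) := by
      rw [← Matrix.mul_assoc, ← hD'L, Matrix.mul_assoc]
    rw [e1, Matrix.mul_assoc D', ← Matrix.mul_add]
    have e2 : L * (L * Z * J - Z * J * A) + (L * Z * J - Z * J * A) * A = D * D * (Z * J) := by
      rw [hDD]
      have e3 : Z * J * A * A = -(K • (Z * J)) := by
        rw [Matrix.mul_assoc (Z * J), hA, Matrix.mul_neg, Matrix.mul_smul, Matrix.mul_one]
      rw [Matrix.sub_mul, e3, Matrix.mul_sub, Matrix.add_mul, Matrix.smul_mul, Matrix.one_mul]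
      simp only [Matrix.mul_assoc]
      abel
    rw [e2, Matrix.mul_assoc D, ← Matrix.mul_assoc, hD'D, Matrix.one_mul]
  calc _ = k • (Y₁ * G₁⁻¹ * (L * (Z₁ * J) + Z₁ * J * A)) := by
        simp only [Matrix.mul_add, smul_add, Matrix.smul_mul, Matrix.mul_assoc]
    _ = k • (Y₁ * G₁⁻¹ * D * (Z * J)) := by rw [hZA]; simp only [Matrix.mul_assoc]
    _ = _ := by
        rw [hB]
        simp only [Matrix.add_mul, smul_add, Matrix.mul_smul, Matrix.mul_assoc]

/-- Evolution of the dressing matrix `W = k Y G⁻¹ Y† J`. -/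
theorem hasEntryDerivAt_dressing {G : ℝ → Matrix n n ℂ} {L : Matrix n n ℂ}
    {Y : ℝ → Matrix m n ℂ} {J Q : Matrix m m ℂ} {k : ℂ} {s : ℝ} (hG : ∀ u, (G u).det ≠ 0)
    (hL : Lᴴ = L) (hJ : Jᴴ = J) (hQ : Qᴴ = Q) (hJJ : J * J = 1) (hQJ : Q * J = -(J * Q))
    (hLG : L * G s - G s * L = k • ((Y s)ᴴ * J * Y s))
    (hG' : HasEntryDerivAt G (-(Complex.I / 4 * k) • ((Y s)ᴴ * Y s)) s)
    (hY' : HasEntryDerivAt Y ((Complex.I / 4) • (J * Y s * L) + Q * Y s) s) :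
    HasEntryDerivAt (fun u => k • (Y u * (G u)⁻¹ * (Y u)ᴴ * J))
      ((Complex.I / 4) • (J * (k • (Y s * (G s)⁻¹ * L * (Y s)ᴴ * J))
          - k • (Y s * (G s)⁻¹ * L * (Y s)ᴴ * J) * J)
        + (Q - (Complex.I / 4) • (J * (k • (Y s * (G s)⁻¹ * (Y s)ᴴ * J))
            - k • (Y s * (G s)⁻¹ * (Y s)ᴴ * J) * J)) * (k • (Y s * (G s)⁻¹ * (Y s)ᴴ * J))
        - k • (Y s * (G s)⁻¹ * (Y s)ᴴ * J) * Q) s := by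
  have hP := hG'.inv hG
  have h := (((hY'.mul hP).mul hY'.conjTranspose).mul_const J).const_smul k
  refine h.congr_deriv ?_
  have hu := (hG s).isUnit
  generalize hPe : (G s)⁻¹ = P
  have hYL : Y s * L * P = Y s * P * L - k • (Y s * P * (Y s)ᴴ * J * Y s * P) := by
    have h7 := congrArg (fun X => Y s * (P * X * P)) hLG
    simp only [Matrix.mul_sub, Matrix.sub_mul, Matrix.mul_smul, Matrix.smul_mul] at h7
    have e1 : P * (L * G s) * P = P * L := by
      rw [← hPe, ← Matrix.mul_assoc, Matrix.mul_nonsing_inv_cancel_right _ _ hu]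
    have e2 : P * (G s * L) * P = L * P := by
      rw [← hPe, Matrix.nonsing_inv_mul_cancel_left _ _ hu]
    rw [e1, e2] at h7
    simp only [Matrix.mul_assoc] at h7 ⊢
    rw [← h7]
    abel
  simp only [Matrix.conjTranspose_add, Matrix.conjTranspose_smul, Matrix.conjTranspose_mul,
    hL, hJ, hQ]
  have hI : star (Complex.I / 4) = -(Complex.I / 4) := by
    simp [neg_div]
  rw [hI]
  generalize Complex.I / 4 = c
  generalize (Y s)ᴴ = X at *
  generalize Y s = V at *
  simp only [Matrix.add_mul, Matrix.mul_add, Matrix.smul_mul, Matrix.mul_smul, Matrix.neg_mul,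
    Matrix.mul_neg, smul_add, smul_neg, neg_smul, Matrix.sub_mul, smul_sub,
    smul_smul, neg_neg]
  -- `r1`, `r2`, `r3` rewrite products to a normal form: `L` moves right past `P`, `J * J`
  -- disappears, and `Q` moves right past `J`. The remaining identity is linear in the words.
  have r1 : J * V * L * P * X * J = J * V * P * L * X * J
      - k • (J * V * P * X * J * V * P * X * J) := by
    have := congrArg (fun T => J * T * X * J) hYL
    simpa only [Matrix.mul_sub, Matrix.sub_mul, Matrix.mul_smul, Matrix.smul_mul,
      ← Matrix.mul_assoc] using this
  have r2 : ∀ T : Matrix m m ℂ, T * J * J = T := fun T => by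
    rw [Matrix.mul_assoc, hJJ, Matrix.mul_one]
  have r3 : ∀ T : Matrix m m ℂ, T * Q * J = -(T * J * Q) := fun T => by
    rw [Matrix.mul_assoc, hQJ, Matrix.mul_neg, Matrix.mul_assoc]
  simp only [← Matrix.mul_assoc]
  rw [r1]
  simp only [r2, r3, smul_sub, smul_smul, smul_neg]
  module

/-- If `A` and `W` evolve according to the seed and the dressing, then the dressed potential
`A + W₁ - W` satisfies the dressed zero-curvature equation. -/
theorem dressed_zeroCurvature {A W W₁ T T₁ Q Q₁ j : Matrix m m ℂ}
    (hQ : Q₁ = Q + A * j - j * A)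
    (hT : T₁ = T + (A + W₁ - W) * W - W₁ * A) :
    (Q₁ * A - A * Q)
      + (j * T₁ - T₁ * j + (Q₁ - (j * W₁ - W₁ * j)) * W₁ - W₁ * Q₁)
      - (j * T - T * j + (Q - (j * W - W * j)) * W - W * Q)
    = (Q₁ - (j * W₁ - W₁ * j)) * (A + W₁ - W) - (A + W₁ - W) * (Q - (j * W - W * j)) := by
  subst hT hQ
  noncomm_ring

end Dressing

/-! ### Plane wave seed -/

/-- The unimodular number `e^{iφ}`. -/
def phaseW (φ : ℝ) : ℂ := Complex.exp (Complex.I * φ)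

/-- The half phase `e^{iθ_n/2}` of the plane wave. -/
def halfPhase (a b γ : ℝ) (n : ℤ) (s : ℝ) : ℂ := Complex.exp (Complex.I / 2 * theta a b γ n s)

/-- The real exponential `e^{Z_n}`. -/
def amp (a b β γ φ κ : ℝ) (n : ℤ) (s : ℝ) : ℂ := Complex.exp (Z a b β γ φ κ n s)

/-- `aγ / (2 sin (b/2))`. -/
def seedT (a b γ : ℝ) : ℂ := a * γ / (2 * Real.sin (b / 2))

/-- The spectral parameter `β/2 (w + 1/w) - c` of the point of the spectral curve with
`c + λ ± ξ = β w^{±1}`. -/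
def seedLam (a b β γ : ℝ) (w : ℂ) : ℂ := β / 2 * (w + w⁻¹) - seedC a b γ

/-- The factor by which the eigenvector with parameter `w` is multiplied by `λ U_n`. -/
def seedMult (a b β γ : ℝ) (w : ℂ) : ℂ :=
  seedT a b γ + β / 2 * (phaseW (b / 2) * w + (phaseW (b / 2) * w)⁻¹)

/-- The constant `K` with `λ² det U_n = λ² + K`. -/
def seedK (a b β γ : ℝ) : ℂ :=
  ((β / 2) ^ 2 - seedT a b γ ^ 2 / 4) * (phaseW (b / 2) - (phaseW (b / 2))⁻¹) ^ 2

/-- The coefficient of `1/λ` in `U_n`. -/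
def seedA (a b β γ : ℝ) (n : ℤ) (s : ℝ) : Matrix (Fin 2) (Fin 2) ℂ :=
  !![-(Complex.I * a * γ / 2), star (seedQ a b β γ (n + 1) s) - star (seedQ a b β γ n s);
    seedQ a b β γ (n + 1) s - seedQ a b β γ n s, Complex.I * a * γ / 2]

/-- The part of `V_n` that does not depend on the spectral parameter. -/
def seedPot (a b β γ : ℝ) (n : ℤ) (s : ℝ) : Matrix (Fin 2) (Fin 2) ℂ :=
  !![0, -(Complex.I / 2 * star (seedQ a b β γ n s)); Complex.I / 2 * seedQ a b β γ n s, 0]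

/-- The signature matrix `diag (1, -1)`. -/
def sigJ : Matrix (Fin 2) (Fin 2) ℂ := !![1, 0; 0, -1]

theorem phaseW_ne_zero (φ : ℝ) : phaseW φ ≠ 0 := Complex.exp_ne_zero _

theorem halfPhase_ne_zero (a b γ : ℝ) (n : ℤ) (s : ℝ) : halfPhase a b γ n s ≠ 0 :=
  Complex.exp_ne_zero _

theorem star_phaseW (φ : ℝ) : star (phaseW φ) = (phaseW φ)⁻¹ := by
  rw [phaseW, ← Complex.exp_neg, Complex.star_def, ← Complex.exp_conj]
  simp

theorem star_halfPhase (a b γ : ℝ) (n : ℤ) (s : ℝ) :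
    star (halfPhase a b γ n s) = (halfPhase a b γ n s)⁻¹ := by
  rw [halfPhase, ← Complex.exp_neg, Complex.star_def, ← Complex.exp_conj]
  congr 1
  rw [map_mul, map_div₀, Complex.conj_I, Complex.conj_ofReal, Complex.conj_ofNat]
  ring

theorem star_amp (a b β γ φ κ : ℝ) (n : ℤ) (s : ℝ) :
    star (amp a b β γ φ κ n s) = amp a b β γ φ κ n s := by
  rw [amp, Complex.star_def, ← Complex.exp_conj, Complex.conj_ofReal]

theorem cos_eq_phaseW (φ : ℝ) : ((Real.cos φ : ℝ) : ℂ) = (phaseW φ + (phaseW φ)⁻¹) / 2 := by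
  rw [phaseW, ← Complex.exp_neg, Complex.ofReal_cos, Complex.cos]
  ring_nf

theorem sin_eq_phaseW (φ : ℝ) :
    ((Real.sin φ : ℝ) : ℂ) = -Complex.I * (phaseW φ - (phaseW φ)⁻¹) / 2 := by
  rw [phaseW, ← Complex.exp_neg, Complex.ofReal_sin, Complex.sin]
  ring_nf

theorem phaseW_add (φ ψ : ℝ) : phaseW (φ + ψ) = phaseW φ * phaseW ψ := by
  rw [phaseW, phaseW, phaseW, ← Complex.exp_add]
  push_cast
  ring_nf

theorem phaseW_neg (φ : ℝ) : phaseW (-φ) = (phaseW φ)⁻¹ := by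
  rw [phaseW, phaseW, ← Complex.exp_neg]
  push_cast
  ring_nf

theorem phaseW_im (φ : ℝ) : (phaseW φ).im = Real.sin φ := by
  rw [phaseW, mul_comm, Complex.exp_ofReal_mul_I_im]

theorem phaseW_inv_sub_ne_zero {φ ψ : ℝ} (h1 : 0 < Real.sin φ) (h2 : 0 < Real.sin ψ) :
    (phaseW φ)⁻¹ - phaseW ψ ≠ 0 := by
  intro h
  have h3 := congrArg Complex.im h
  rw [← phaseW_neg, Complex.sub_im, phaseW_im, phaseW_im, Real.sin_neg, Complex.zero_im] at h3
  linarith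

theorem seedQ_eq (a b β γ : ℝ) (n : ℤ) (s : ℝ) :
    seedQ a b β γ n s = β / 2 * halfPhase a b γ n s ^ 2 := by
  rw [seedQ, halfPhase, ← Complex.exp_nat_mul]
  push_cast
  ring_nf

theorem star_seedQ (a b β γ : ℝ) (n : ℤ) (s : ℝ) :
    star (seedQ a b β γ n s) = β / 2 * (halfPhase a b γ n s)⁻¹ ^ 2 := by
  rw [seedQ_eq, star_mul', star_pow, star_halfPhase]
  simp

theorem halfPhase_succ (a b γ : ℝ) (n : ℤ) (s : ℝ) :
    halfPhase a b γ (n + 1) s = halfPhase a b γ n s * phaseW (b / 2) := by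
  rw [halfPhase, halfPhase, phaseW, ← Complex.exp_add, theta, theta]
  push_cast
  ring_nf

theorem hasDerivAt_theta (a b γ : ℝ) (n : ℤ) (s : ℝ) :
    HasDerivAt (fun u => ((theta a b γ n u : ℝ) : ℂ)) (seedC a b γ / 2 : ℂ) s := by
  have h : HasDerivAt (fun u => theta a b γ n u) (seedC a b γ / 2) s := by
    simpa [theta] using ((hasDerivAt_id s).const_mul (seedC a b γ / 2)).const_add (b * n)
  simpa using h.ofReal_comp

theorem hasDerivAt_halfPhase (a b γ : ℝ) (n : ℤ) (s : ℝ) :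
    HasDerivAt (halfPhase a b γ n) (Complex.I / 4 * seedC a b γ * halfPhase a b γ n s) s := by
  have h := ((hasDerivAt_theta a b γ n s).const_mul (Complex.I / 2)).cexp
  refine h.congr_deriv ?_
  rw [halfPhase]
  ring

theorem hasDerivAt_seedQ (a b β γ : ℝ) (n : ℤ) (s : ℝ) :
    HasDerivAt (seedQ a b β γ n) (Complex.I / 2 * seedC a b γ * seedQ a b β γ n s) s := by
  have h := ((hasDerivAt_halfPhase a b γ n s).pow 2).const_mul (β / 2 : ℂ)
  have he : seedQ a b β γ n = fun u => (β / 2 : ℂ) * (halfPhase a b γ n ^ 2) u :=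
    funext fun u => seedQ_eq a b β γ n u
  rw [he]
  refine h.congr_deriv ?_
  simp only [Pi.pow_apply]
  push_cast
  ring

/-! ### Plane-wave identities as Laurent polynomials in `e^{ib/2}` and `w` -/

section SinNeZero

variable {a b β γ : ℝ} (hs : Real.sin (b / 2) ≠ 0)
include hs

/-- Half-angle formulas give `c = -seedT · cos(b/2)`. With the companion formula for `i a γ / 2`,
every seed quantity becomes a Laurent polynomial in `e^{ib/2}`, so the identities below are
polynomial ones. -/
theorem seedC_eq : (seedC a b γ : ℂ)
    = -(seedT a b γ * (phaseW (b / 2) + (phaseW (b / 2))⁻¹) / 2) := by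
  have h1 : Real.cos b - 1 = -(2 * Real.sin (b / 2) ^ 2) := by
    have := Real.cos_sq' (b / 2)
    have h2 := Real.cos_two_mul (b / 2)
    rw [show 2 * (b / 2) = b by ring] at h2
    rw [h2, this]
    ring
  have h3 : Real.sin b = 2 * Real.sin (b / 2) * Real.cos (b / 2) := by
    rw [← Real.sin_two_mul, show 2 * (b / 2) = b by ring]
  have h4 : seedC a b γ = -(a * γ / (2 * Real.sin (b / 2)) * Real.cos (b / 2)) := by
    rw [seedC, h1, h3]
    field_simp
  rw [h4, seedT]
  push_cast
  rw [← Complex.ofReal_ofNat 2, ← Complex.ofReal_div, ← Complex.ofReal_cos, cos_eq_phaseW]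
  push_cast
  ring

theorem seed_aγ_eq : Complex.I * a * γ / 2
    = seedT a b γ * (phaseW (b / 2) - (phaseW (b / 2))⁻¹) / 2 := by
  have hs' : ((Real.sin (b / 2) : ℝ) : ℂ) ≠ 0 := by exact_mod_cast hs
  have h := sin_eq_phaseW (b / 2)
  have h2 : phaseW (b / 2) - (phaseW (b / 2))⁻¹ = 2 * Complex.I * (Real.sin (b / 2) : ℝ) := by
    rw [h]
    linear_combination (phaseW (b / 2) - (phaseW (b / 2))⁻¹) * Complex.I_sq
  rw [seedT, h2]
  field_simp

/-- First row of `(λ + A)` applied to the eigenvector `(1, w⁻¹)` with the half phases stripped off;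
the factor `(phaseW (b / 2))⁻¹` on the right comes from the half phase at `n + 1`. -/
theorem seed_shift_fst {w : ℂ} (hw : w ≠ 0) :
    (seedLam a b β γ w - Complex.I * a * γ / 2) + β / 2 * ((phaseW (b / 2))⁻¹ ^ 2 - 1) * w⁻¹
      = (phaseW (b / 2))⁻¹ * seedMult a b β γ w := by
  have hz := phaseW_ne_zero (b / 2)
  rw [seed_aγ_eq hs, seedLam, seedC_eq hs, seedMult]
  field_simp
  ring

theorem seed_shift_snd {w : ℂ} (hw : w ≠ 0) :
    β / 2 * (phaseW (b / 2) ^ 2 - 1) + (seedLam a b β γ w + Complex.I * a * γ / 2) * w⁻¹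
      = phaseW (b / 2) * seedMult a b β γ w * w⁻¹ := by
  have hz := phaseW_ne_zero (b / 2)
  rw [seed_aγ_eq hs, seedLam, seedC_eq hs, seedMult]
  field_simp
  ring

/-- `w` and `w⁻¹` give the two eigenvectors over the same `λ`, so the product of their multipliers
is `det(λ + A) = λ² + K`. -/
theorem seedMult_mul_inv {w : ℂ} (hw : w ≠ 0) :
    seedMult a b β γ w * seedMult a b β γ w⁻¹ = seedLam a b β γ w ^ 2 + seedK a b β γ := by
  have hz := phaseW_ne_zero (b / 2)
  rw [seedMult, seedMult, seedLam, seedC_eq hs, seedK]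
  field_simp
  ring

/-- Two-point version of the determinant identity. The correction carries the factor `w⁻¹ - v`,
which cancels the denominators of `G` in `darkG_shift`; the other factor is the form `Y† J A Y`
without its amplitudes. -/
theorem seedMult_mul {w v : ℂ} (hw : w ≠ 0) (hv : v ≠ 0) :
    seedMult a b β γ w * seedMult a b β γ v
      = seedLam a b β γ w * seedLam a b β γ v + seedK a b β γ
        + β / 2 * (w⁻¹ - v) * (-(Complex.I * a * γ / 2) * (1 + w * v⁻¹)
          + β / 2 * ((phaseW (b / 2))⁻¹ ^ 2 - 1) * v⁻¹
          - β / 2 * (phaseW (b / 2) ^ 2 - 1) * w) := by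
  have hz := phaseW_ne_zero (b / 2)
  rw [seed_aγ_eq hs, seedMult, seedMult, seedLam, seedLam, seedC_eq hs, seedK]
  field_simp
  ring

theorem seedA_sq (n : ℤ) (s : ℝ) :
    seedA a b β γ n s * seedA a b β γ n s = -(seedK a b β γ • 1) := by
  have hz := phaseW_ne_zero (b / 2)
  have hE := halfPhase_ne_zero a b γ n s
  ext i j
  simp only [seedA, star_seedQ]
  simp only [seedK, seedQ_eq, halfPhase_succ, Matrix.mul_apply, Fin.sum_univ_two, seed_aγ_eq hs]
  fin_cases i <;> fin_cases j <;> simp <;> field_simp <;> ring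

theorem seed_zeroCurvature_apply (n : ℤ) (s : ℝ) :
    (seedPot a b β γ (n + 1) s * seedA a b β γ n s - seedA a b β γ n s * seedPot a b β γ n s) 1 0
      = Complex.I / 2 * seedC a b γ * (seedQ a b β γ (n + 1) s - seedQ a b β γ n s) := by
  have hz := phaseW_ne_zero (b / 2)
  have hE := halfPhase_ne_zero a b γ n s
  simp only [seedA, seedPot, star_seedQ]
  simp only [seedQ_eq, halfPhase_succ, Matrix.mul_apply, Fin.sum_univ_two, seed_aγ_eq hs,
    Matrix.sub_apply, seedC_eq hs]
  simp
  field_simp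
  ring

end SinNeZero

/-- The coefficient of `λ` in the zero-curvature condition of the seed. -/
theorem seedPot_succ (a b β γ : ℝ) (n : ℤ) (s : ℝ) :
    seedPot a b β γ (n + 1) s = seedPot a b β γ n s
      + seedA a b β γ n s * ((Complex.I / 4) • sigJ) - ((Complex.I / 4) • sigJ) * seedA a b β γ n s := by
  ext i j
  fin_cases i <;> fin_cases j <;>
    simp [seedA, seedPot, sigJ] <;> ring

theorem sigJ_sq : sigJ * sigJ = 1 := by
  ext i j
  fin_cases i <;> fin_cases j <;> simp [sigJ]

theorem sigJ_conjTranspose : sigJᴴ = sigJ := by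
  ext i j
  fin_cases i <;> fin_cases j <;> simp [sigJ]

theorem seedPot_conjTranspose (a b β γ : ℝ) (n : ℤ) (s : ℝ) :
    (seedPot a b β γ n s)ᴴ = seedPot a b β γ n s := by
  ext i j
  fin_cases i <;> fin_cases j <;> simp [seedPot] <;> ring

theorem seedPot_mul_sigJ (a b β γ : ℝ) (n : ℤ) (s : ℝ) :
    seedPot a b β γ n s * sigJ = -(sigJ * seedPot a b β γ n s) := by
  ext i j
  fin_cases i <;> fin_cases j <;> simp [seedPot, sigJ]

theorem seedA_conjTranspose_mul_sigJ (a b β γ : ℝ) (n : ℤ) (s : ℝ) :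
    (seedA a b β γ n s)ᴴ * sigJ = -(sigJ * seedA a b β γ n s) := by
  ext i j
  fin_cases i <;> fin_cases j <;>
    simp [seedA, sigJ, Matrix.mul_apply, Fin.sum_univ_two, Matrix.conjTranspose_apply,
      Complex.conj_ofNat] <;> ring

/-! ### Eigenvectors at the real spectral parameters -/

section Dark

variable {N : ℕ} (a b β γ : ℝ) (φ κ : Fin N → ℝ)

/-- The eigenvectors of the seed at the real spectral parameters, as the columns of a matrix. -/
def darkY (n : ℤ) (s : ℝ) : Matrix (Fin 2) (Fin N) ℂ :=
  Matrix.of ![fun j => (halfPhase a b γ n s)⁻¹ * amp a b β γ (φ j) (κ j) n s,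
    fun j => halfPhase a b γ n s * amp a b β γ (φ j) (κ j) n s * (phaseW (φ j))⁻¹]

/-- The diagonal matrix of the real spectral parameters `β cos φ_i - c`. -/
def darkL : Matrix (Fin N) (Fin N) ℂ :=
  Matrix.diagonal fun j => seedLam a b β γ (phaseW (φ j))

/-- The factor by which the shift `n ↦ n + 1` multiplies `e^{Z_n}`. -/
def growth (a b β γ φ : ℝ) : ℝ := Real.exp (1 / 2 * Real.log (growthRatio a b β γ φ))

/-- The normalized factor of the eigenvector under the shift. -/
def darkMu (a b β γ φ : ℝ) : ℝ :=
  (a * γ + 2 * β * Real.sin (b / 2) * Real.cos (b / 2 - φ)) / (2 * Real.sin (b / 2))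
    * growth a b β γ φ

theorem seedLam_phaseW (ψ : ℝ) :
    seedLam a b β γ (phaseW ψ) = ((β * Real.cos ψ - seedC a b γ : ℝ) : ℂ) := by
  rw [seedLam, Complex.ofReal_sub, Complex.ofReal_mul, cos_eq_phaseW]
  ring

theorem amp_succ (ψ μ : ℝ) (n : ℤ) (s : ℝ) :
    amp a b β γ ψ μ (n + 1) s = amp a b β γ ψ μ n s * growth a b β γ ψ := by
  rw [amp, amp, growth, Complex.ofReal_exp, ← Complex.exp_add, ← Complex.ofReal_add, Z, Z]
  congr 2
  push_cast
  ring

theorem hasDerivAt_amp (ψ μ : ℝ) (n : ℤ) (s : ℝ) :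
    HasDerivAt (amp a b β γ ψ μ n)
      (-(β / 4 * Real.sin ψ : ℝ) * amp a b β γ ψ μ n s) s := by
  have h1 : HasDerivAt (fun u => Z a b β γ ψ μ n u) (-(β / 4 * Real.sin ψ)) s := by
    have := (((hasDerivAt_id s).const_mul (β / 4 * Real.sin ψ)).const_sub
      ((n : ℝ) / 2 * Real.log (growthRatio a b β γ ψ))).add_const μ
    simpa [Z] using this
  refine h1.ofReal_comp.cexp.congr_deriv ?_
  rw [amp]
  push_cast
  ring

theorem darkG_apply (n : ℤ) (s : ℝ) (i j : Fin N) :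
    darkG a b β γ φ κ n s i j
      = ((if i = j then 1 else 0) + amp a b β γ (φ i) (κ i) n s * amp a b β γ (φ j) (κ j) n s)
        / ((phaseW (φ i))⁻¹ - phaseW (φ j)) := by
  rw [darkG, Matrix.of_apply, Complex.exp_add, Complex.exp_neg]
  rfl

theorem darkH_apply (n : ℤ) (s : ℝ) (i j : Fin N) :
    darkH a b β γ φ κ n s i j
      = ((if i = j then 1 else 0) + amp a b β γ (φ i) (κ i) n s * (phaseW (φ i))⁻¹
          * (amp a b β γ (φ j) (κ j) n s * (phaseW (φ j))⁻¹))
        / ((phaseW (φ i))⁻¹ - phaseW (φ j)) := by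
  rw [darkH, Matrix.of_apply, Complex.exp_add, Complex.exp_neg, Complex.exp_sub, Complex.exp_sub]
  rfl

theorem darkG_conjTranspose (n : ℤ) (s : ℝ) :
    (darkG a b β γ φ κ n s)ᴴ = -darkG a b β γ φ κ n s := by
  ext i j
  rw [Matrix.conjTranspose_apply, Matrix.neg_apply, darkG_apply, darkG_apply, star_div₀, star_add,
    star_mul', star_amp, star_amp, star_sub, star_inv₀, star_phaseW, star_phaseW, inv_inv,
    ← div_neg, neg_sub]
  congr 1
  rw [mul_comm]
  by_cases h : i = j
  · simp [h]
  · simp [h, Ne.symm h]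

/-- One formula for all the sesquilinear forms that occur: it is applied with `X = J`, `X = 1` and
`X = J A`. -/
theorem darkY_conjTranspose_mul (X : Matrix (Fin 2) (Fin 2) ℂ) (n : ℤ) (s : ℝ) (i j : Fin N) :
    ((darkY a b β γ φ κ n s)ᴴ * X * darkY a b β γ φ κ n s) i j
      = amp a b β γ (φ i) (κ i) n s * amp a b β γ (φ j) (κ j) n s
        * (X 0 0 + X 1 1 * phaseW (φ i) * (phaseW (φ j))⁻¹
          + X 0 1 * halfPhase a b γ n s ^ 2 * (phaseW (φ j))⁻¹
          + X 1 0 * (halfPhase a b γ n s)⁻¹ ^ 2 * phaseW (φ i)) := by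
  have hE := halfPhase_ne_zero a b γ n s
  have h0 : ∀ r : Fin N, star (darkY a b β γ φ κ n s 0 r)
      = halfPhase a b γ n s * amp a b β γ (φ r) (κ r) n s := fun r => by
    simp only [darkY, Matrix.of_apply, Matrix.cons_val_zero]
    rw [star_mul', star_inv₀, star_halfPhase, star_amp, inv_inv]
  have h1 : ∀ r : Fin N, star (darkY a b β γ φ κ n s 1 r)
      = (halfPhase a b γ n s)⁻¹ * amp a b β γ (φ r) (κ r) n s * phaseW (φ r) := fun r => by
    simp only [darkY, Matrix.of_apply, Matrix.cons_val_one, Matrix.cons_val_fin_one]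
    rw [star_mul', star_mul', star_inv₀, star_halfPhase, star_amp, star_phaseW, inv_inv]
  simp only [Matrix.mul_apply, Fin.sum_univ_two, Matrix.conjTranspose_apply, h0, h1]
  simp only [darkY, Matrix.of_apply, Matrix.cons_val_zero, Matrix.cons_val_one,
    Matrix.cons_val_fin_one]
  field_simp
  ring

section Angles

variable (hφ : ∀ i, 0 < Real.sin (φ i))
include hφ

/-- For `v` in the kernel, `v† G v` is `i` times the sum of `|v_i|² / (2 sin φ_i)` and a nonnegative
Cauchy form at the points `e^{iφ_i}`. Both parts must vanish, hence `v = 0`. The angles may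
coincide, because the diagonal part alone is already definite. -/
theorem darkG_det_ne_zero (n : ℤ) (s : ℝ) : (darkG a b β γ φ κ n s).det ≠ 0 := by
  intro hdet
  obtain ⟨v, hv, hGv⟩ := Matrix.exists_mulVec_eq_zero_iff.mpr hdet
  obtain ⟨r, hr, hcauchy⟩ := cauchy_form_nonneg (fun i => phaseW (φ i))
    (fun i => by rw [phaseW_im]; exact hφ i) (fun i => amp a b β γ (φ i) (κ i) n s * v i)
  have h1 : ∑ i, ∑ j, star (v i) * darkG a b β γ φ κ n s i j * v j = 0 := by
    have : star v ⬝ᵥ (darkG a b β γ φ κ n s *ᵥ v) = 0 := by rw [hGv, dotProduct_zero]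
    rw [← this]
    simp only [dotProduct, Matrix.mulVec, Finset.mul_sum, Pi.star_apply, mul_assoc]
  have h2 : ∀ i, (1 : ℂ) / ((phaseW (φ i))⁻¹ - phaseW (φ i))
      = Complex.I * ((1 / (2 * Real.sin (φ i)) : ℝ) : ℂ) := by
    intro i
    have h3 : (phaseW (φ i))⁻¹ - phaseW (φ i) = -(2 * Complex.I * (Real.sin (φ i) : ℝ)) := by
      rw [sin_eq_phaseW]
      linear_combination ((phaseW (φ i))⁻¹ - phaseW (φ i)) * Complex.I_sq
    have h4 : ((Real.sin (φ i) : ℝ) : ℂ) ≠ 0 := by exact_mod_cast (hφ i).ne'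
    rw [h3, Complex.ofReal_div, Complex.ofReal_mul, Complex.ofReal_one, Complex.ofReal_ofNat]
    have hI := Complex.I_ne_zero
    field_simp
    linear_combination -Complex.I_sq
  have h5 : Complex.I * ((∑ i, ‖v i‖ ^ 2 * (1 / (2 * Real.sin (φ i))) + r : ℝ) : ℂ) = 0 := by
    rw [← h1, Complex.ofReal_add, mul_add, ← hcauchy, Complex.ofReal_sum, Finset.mul_sum,
      ← Finset.sum_add_distrib]
    refine Finset.sum_congr rfl fun i _ => ?_
    have h6 : ∀ j, star (v i) * darkG a b β γ φ κ n s i j * v j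
        = (if i = j then star (v i) * v j / ((phaseW (φ i))⁻¹ - phaseW (φ j)) else 0)
          + star (amp a b β γ (φ i) (κ i) n s * v i) * (amp a b β γ (φ j) (κ j) n s * v j)
            / (star (phaseW (φ i)) - phaseW (φ j)) := by
      intro j
      rw [darkG_apply, star_phaseW, star_mul', star_amp]
      by_cases h : i = j
      · rw [if_pos h, if_pos h]; ring
      · rw [if_neg h, if_neg h]; ring
    simp only [h6, Finset.sum_add_distrib, Finset.sum_ite_eq, Finset.mem_univ, if_true]
    congr 1
    rw [div_eq_mul_one_div (star (v i) * v i), h2, Complex.star_def, ← Complex.normSq_eq_conj_mul_self,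
      Complex.normSq_eq_norm_sq, Complex.ofReal_mul]
    ring
  have h7 := (mul_eq_zero.mp h5).resolve_left Complex.I_ne_zero
  rw [Complex.ofReal_eq_zero] at h7
  have h8 : ∀ i ∈ Finset.univ, 0 ≤ ‖v i‖ ^ 2 * (1 / (2 * Real.sin (φ i))) := fun i _ => by
    have := hφ i
    positivity
  have h9 : ∑ i, ‖v i‖ ^ 2 * (1 / (2 * Real.sin (φ i))) = 0 :=
    le_antisymm (by linarith) (Finset.sum_nonneg h8)
  refine hv (funext fun i => ?_)
  have h10 := (Finset.sum_eq_zero_iff_of_nonneg h8).mp h9 i (Finset.mem_univ i)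
  have h11 : (1 / (2 * Real.sin (φ i))) ≠ 0 := by
    have := hφ i
    positivity
  simpa using (mul_eq_zero.mp h10).resolve_right h11

/-- Rests on `λ_i - λ_j = (β/2) (w_i⁻¹ - w_j) (1 - w_i/w_j)` with `w_i = e^{iφ_i}`: the first
bracket is the denominator of `G`. The `δ_ij` part commutes with `Λ`. Nothing is divided by `λ_i -
λ_j` or `β`, so repeated angles and `β = 0` are covered. -/
theorem darkL_commutator (n : ℤ) (s : ℝ) :
    darkL a b β γ φ * darkG a b β γ φ κ n s - darkG a b β γ φ κ n s * darkL a b β γ φ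
      = (β / 2 : ℂ) • ((darkY a b β γ φ κ n s)ᴴ * sigJ * darkY a b β γ φ κ n s) := by
  ext i j
  have hi := phaseW_ne_zero (φ i)
  have hj := phaseW_ne_zero (φ j)
  have hd := phaseW_inv_sub_ne_zero (hφ i) (hφ j)
  rw [Matrix.smul_apply, darkY_conjTranspose_mul, Matrix.sub_apply, darkL, Matrix.diagonal_mul,
    Matrix.mul_diagonal, darkG_apply, seedLam, seedLam]
  simp only [sigJ, Matrix.of_apply, Matrix.cons_val_zero, Matrix.cons_val_one, smul_eq_mul,
    Matrix.cons_val']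
  by_cases h : i = j
  · subst h
    field_simp
    ring
  · rw [if_neg h]
    have h1 : ∀ x y z d : ℂ, x * (y / d) - y / d * z = (x - z) * y / d := fun x y z d => by ring
    rw [h1, div_eq_iff hd]
    field_simp
    ring

/-- The denominator cancels because `sin φ_i + sin φ_j = (i/2) (w_i⁻¹ - w_j) (1 + w_i/w_j)`. -/
theorem hasEntryDerivAt_darkG (n : ℤ) (s : ℝ) :
    HasEntryDerivAt (darkG a b β γ φ κ n)
      (-(Complex.I / 4 * (β / 2)) • ((darkY a b β γ φ κ n s)ᴴ * darkY a b β γ φ κ n s)) s := by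
  intro i j
  have hi := phaseW_ne_zero (φ i)
  have hj := phaseW_ne_zero (φ j)
  have hd := phaseW_inv_sub_ne_zero (hφ i) (hφ j)
  have h := (((hasDerivAt_amp a b β γ (φ i) (κ i) n s).mul
    (hasDerivAt_amp a b β γ (φ j) (κ j) n s)).const_add
      (if i = j then (1 : ℂ) else 0)).div_const ((phaseW (φ i))⁻¹ - phaseW (φ j))
  simp only [darkG_apply]
  refine h.congr_deriv ?_
  rw [Matrix.smul_apply, ← Matrix.mul_one (darkY a b β γ φ κ n s)ᴴ, darkY_conjTranspose_mul,
    Complex.ofReal_mul, Complex.ofReal_mul, sin_eq_phaseW, sin_eq_phaseW]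
  rw [div_eq_iff hd]
  simp
  field_simp
  ring

end Angles

theorem hasEntryDerivAt_darkY (n : ℤ) (s : ℝ) :
    HasEntryDerivAt (darkY a b β γ φ κ n)
      ((Complex.I / 4) • (sigJ * darkY a b β γ φ κ n s * darkL a b β γ φ)
        + seedPot a b β γ n s * darkY a b β γ φ κ n s) s := by
  have hE := halfPhase_ne_zero a b γ n s
  have h1 := hasDerivAt_halfPhase a b γ n s
  intro i j
  have hj := phaseW_ne_zero (φ j)
  have h2 := hasDerivAt_amp a b β γ (φ j) (κ j) n s
  have hI := Complex.I_sq
  rw [Matrix.add_apply, Matrix.smul_apply, darkL, Matrix.mul_diagonal, Matrix.mul_apply,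
    Matrix.mul_apply, Fin.sum_univ_two, Fin.sum_univ_two, seedLam, seedPot, star_seedQ, seedQ_eq]
  rw [Complex.ofReal_mul, sin_eq_phaseW] at h2
  fin_cases i
  · have h := (h1.inv hE).mul h2
    simp only [darkY]
    refine h.congr_deriv ?_
    simp [sigJ]
    field_simp
    ring
  · have h := (h1.mul h2).mul_const (phaseW (φ j))⁻¹
    simp only [darkY]
    refine h.congr_deriv ?_
    simp [sigJ]
    field_simp
    ring

/-! ### The shift `n ↦ n + 1` at the real spectral parameters -/

section Shift

variable (hs : Real.sin (b / 2) ≠ 0)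
include hs

theorem seedMult_phaseW (ψ : ℝ) : seedMult a b β γ (phaseW ψ)
    = (((a * γ + 2 * β * Real.sin (b / 2) * Real.cos (b / 2 + ψ)) / (2 * Real.sin (b / 2)) : ℝ)
      : ℂ) := by
  have hs' : ((Real.sin (b / 2) : ℝ) : ℂ) ≠ 0 := by exact_mod_cast hs
  have h := cos_eq_phaseW (b / 2 + ψ)
  rw [phaseW_add] at h
  rw [seedMult, seedT]
  simp only [Complex.ofReal_div, Complex.ofReal_add, Complex.ofReal_mul, h, Complex.ofReal_ofNat]
  field_simp

/-- The eigenvector is multiplied by `seedMult (phaseW ψ)`, of which `growth` is already absorbed in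
`e^{Z_{n+1}}`; `darkMu` is what remains. As `growth²` is the ratio of the multipliers at `e^{iψ}`
and `e^{-iψ}`, the square of `darkMu` is their product. -/
theorem growth_mul_darkMu {ψ : ℝ} (hr : 0 < growthRatio a b β γ ψ) :
    (growth a b β γ ψ : ℂ) * darkMu a b β γ ψ = seedMult a b β γ (phaseW ψ) := by
  rw [seedMult_phaseW a b β γ hs, ← Complex.ofReal_mul]
  congr 1
  have h1 : growth a b β γ ψ * growth a b β γ ψ = growthRatio a b β γ ψ := by
    rw [growth, ← Real.exp_add, ← add_mul, add_halves, one_mul, Real.exp_log hr]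
  have h2 : a * γ + 2 * β * Real.sin (b / 2) * Real.cos (b / 2 - ψ) ≠ 0 := by
    intro h
    rw [growthRatio, h, div_zero] at hr
    exact lt_irrefl _ hr
  rw [darkMu]
  calc _ = (a * γ + 2 * β * Real.sin (b / 2) * Real.cos (b / 2 - ψ)) / (2 * Real.sin (b / 2))
      * (growth a b β γ ψ * growth a b β γ ψ) := by ring
    _ = _ := by
      rw [h1, growthRatio]
      generalize a * γ + 2 * β * Real.sin (b / 2) * Real.cos (b / 2 - ψ) = d at h2
      field_simp

theorem darkMu_eq (ψ : ℝ) :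
    (darkMu a b β γ ψ : ℂ) = seedMult a b β γ (phaseW ψ)⁻¹ * growth a b β γ ψ := by
  rw [← phaseW_neg, seedMult_phaseW a b β γ hs, darkMu, Complex.ofReal_mul, sub_eq_add_neg]

variable (hr : ∀ i, 0 < growthRatio a b β γ (φ i))
include hr

theorem darkMu_ne_zero (i : Fin N) : (darkMu a b β γ (φ i) : ℂ) ≠ 0 := by
  have h2 : a * γ + 2 * β * Real.sin (b / 2) * Real.cos (b / 2 - φ i) ≠ 0 := by
    intro h
    have := hr i
    rw [growthRatio, h, div_zero] at this
    exact lt_irrefl _ this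
  rw [Complex.ofReal_ne_zero, darkMu]
  exact mul_ne_zero (div_ne_zero h2 (mul_ne_zero two_ne_zero hs)) (Real.exp_pos _).ne'

theorem darkY_shift (n : ℤ) (s : ℝ) :
    darkY a b β γ φ κ (n + 1) s * Matrix.diagonal (fun i => (darkMu a b β γ (φ i) : ℂ))
      = darkY a b β γ φ κ n s * darkL a b β γ φ
        + seedA a b β γ n s * darkY a b β γ φ κ n s := by
  have hE := halfPhase_ne_zero a b γ n s
  have hz := phaseW_ne_zero (b / 2)
  ext i j
  have hj := phaseW_ne_zero (φ j)
  have h1 := growth_mul_darkMu a b β γ hs (hr j)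
  have h2 := seed_shift_fst (a := a) (β := β) (γ := γ) hs hj
  have h3 := seed_shift_snd (a := a) (β := β) (γ := γ) hs hj
  rw [Matrix.add_apply, Matrix.mul_diagonal, darkL, Matrix.mul_diagonal, Matrix.mul_apply,
    Fin.sum_univ_two, seedA, star_seedQ, star_seedQ, seedQ_eq, seedQ_eq, halfPhase_succ, darkY,
    darkY, halfPhase_succ, mul_inv]
  fin_cases i
  · simp only [Matrix.of_apply, Matrix.cons_val_zero, Matrix.cons_val_one, Fin.zero_eta,
      Matrix.cons_val', amp_succ]
    rw [show (halfPhase a b γ n s)⁻¹ * (phaseW (b / 2))⁻¹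
      * (amp a b β γ (φ j) (κ j) n s * growth a b β γ (φ j)) * (darkMu a b β γ (φ j))
      = (halfPhase a b γ n s)⁻¹ * amp a b β γ (φ j) (κ j) n s * ((phaseW (b / 2))⁻¹ *
        (growth a b β γ (φ j) * (darkMu a b β γ (φ j)))) by ring, h1, ← h2]
    field_simp
    ring
  · simp only [Matrix.of_apply, Matrix.cons_val_zero, Matrix.cons_val_one, Fin.mk_one,
      Matrix.cons_val', amp_succ]
    rw [show halfPhase a b γ n s * phaseW (b / 2)
      * (amp a b β γ (φ j) (κ j) n s * growth a b β γ (φ j)) * (phaseW (φ j))⁻¹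
        * (darkMu a b β γ (φ j))
      = halfPhase a b γ n s * amp a b β γ (φ j) (κ j) n s * (phaseW (b / 2) *
        (growth a b β γ (φ j) * (darkMu a b β γ (φ j))) * (phaseW (φ j))⁻¹) by ring, h1, ← h3]
    field_simp
    ring

theorem darkMu_mul_darkMu :
    Matrix.diagonal (fun i => (darkMu a b β γ (φ i) : ℂ))
        * Matrix.diagonal (fun i => (darkMu a b β γ (φ i) : ℂ))
      = darkL a b β γ φ * darkL a b β γ φ + seedK a b β γ • 1 := by
  have h : ∀ i, (darkMu a b β γ (φ i) : ℂ) * darkMu a b β γ (φ i)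
      = seedLam a b β γ (phaseW (φ i)) * seedLam a b β γ (phaseW (φ i)) + seedK a b β γ := by
    intro i
    rw [← sq (seedLam a b β γ _), ← seedMult_mul_inv hs (phaseW_ne_zero (φ i)),
      ← growth_mul_darkMu a b β γ hs (hr i)]
    nth_rewrite 1 [darkMu_eq a b β γ hs]
    ring
  rw [darkL, Matrix.diagonal_mul_diagonal, Matrix.diagonal_mul_diagonal, Matrix.smul_one_eq_diagonal,
    Matrix.diagonal_add]
  simp only [h]

/-- The two summands in the numerator of `G` are treated separately: the `δ_ij` part needs only `D²
= Λ² + K`, and the part with `e^{Z_i + Z_j}` is the two-point identity `seedMult_mul` at `e^{iφ_i}`,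
`e^{iφ_j}`. -/
theorem darkG_shift (hφ : ∀ i, 0 < Real.sin (φ i)) (n : ℤ) (s : ℝ) :
    Matrix.diagonal (fun i => (darkMu a b β γ (φ i) : ℂ)) * darkG a b β γ φ κ (n + 1) s
        * Matrix.diagonal (fun i => (darkMu a b β γ (φ i) : ℂ))
      = darkL a b β γ φ * darkG a b β γ φ κ n s * darkL a b β γ φ
        + seedK a b β γ • darkG a b β γ φ κ n s
        + (β / 2 : ℂ) • ((darkY a b β γ φ κ n s)ᴴ * sigJ * seedA a b β γ n s
          * darkY a b β γ φ κ n s) := by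
  have hE := halfPhase_ne_zero a b γ n s
  have hz := phaseW_ne_zero (b / 2)
  ext i j
  have hi := phaseW_ne_zero (φ i)
  have hj := phaseW_ne_zero (φ j)
  have hd := phaseW_inv_sub_ne_zero (hφ i) (hφ j)
  have h1 := growth_mul_darkMu a b β γ hs (hr i)
  have h2 := growth_mul_darkMu a b β γ hs (hr j)
  have h3 := seedMult_mul (a := a) (β := β) (γ := γ) hs hi hj
  have h4 : ((darkY a b β γ φ κ n s)ᴴ * sigJ * seedA a b β γ n s * darkY a b β γ φ κ n s) i j
      = amp a b β γ (φ i) (κ i) n s * amp a b β γ (φ j) (κ j) n s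
        * (-(Complex.I * a * γ / 2) * (1 + phaseW (φ i) * (phaseW (φ j))⁻¹)
          + β / 2 * ((phaseW (b / 2))⁻¹ ^ 2 - 1) * (phaseW (φ j))⁻¹
          - β / 2 * (phaseW (b / 2) ^ 2 - 1) * phaseW (φ i)) := by
    rw [Matrix.mul_assoc _ sigJ, darkY_conjTranspose_mul]
    rw [seedA, star_seedQ, star_seedQ, seedQ_eq, seedQ_eq, halfPhase_succ, mul_inv]
    congr 1
    simp [sigJ]
    field_simp
    ring
  have h5 : (if i = j then (1 : ℂ) else 0)
      * ((darkMu a b β γ (φ i) : ℂ) * darkMu a b β γ (φ j))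
      = (if i = j then (1 : ℂ) else 0) * (seedLam a b β γ (phaseW (φ i))
        * seedLam a b β γ (phaseW (φ j)) + seedK a b β γ) := by
    by_cases h : i = j
    · subst h
      have h6 := congrFun (congrFun (darkMu_mul_darkMu a b β γ φ hs hr) i) i
      rw [darkL, Matrix.diagonal_mul_diagonal, Matrix.diagonal_mul_diagonal,
        Matrix.smul_one_eq_diagonal, Matrix.diagonal_add, Matrix.diagonal_apply_eq,
        Matrix.diagonal_apply_eq] at h6
      rw [h6]
    · rw [if_neg h, zero_mul, zero_mul]
  rw [Matrix.add_apply, Matrix.add_apply, Matrix.smul_apply, Matrix.smul_apply, h4,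
    Matrix.mul_diagonal, Matrix.diagonal_mul, darkL, Matrix.mul_diagonal, Matrix.diagonal_mul,
    darkG_apply, darkG_apply, amp_succ, amp_succ, smul_eq_mul, smul_eq_mul]
  rw [← sub_eq_zero]
  have h7 : ∀ x y z t u d : ℂ, d ≠ 0 → x * (y / d) * z - (t + u) =
      (x * y * z - (t + u) * d) / d := fun x y z t u d hd => by field_simp
  rw [h7 _ _ _ _ _ _ hd, div_eq_zero_iff]
  left
  have h8 : ∀ x y z t u d : ℂ, d ≠ 0 → (x * (y / d) * z + t * (y / d) + u) * d
      = (x * z + t) * y + u * d := fun x y z t u d hd => by field_simp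
  rw [h8 _ _ _ _ _ _ hd]
  linear_combination h5 + amp a b β γ (φ i) (κ i) n s * amp a b β γ (φ j) (κ j) n s *
    (h3 + h1 * (growth a b β γ (φ j)) * (darkMu a b β γ (φ j)) + seedMult a b β γ (phaseW (φ i)) * h2)

end Shift

end Dark

/-! ### The dressed fields -/

section Dressed

variable {N : ℕ} (a b β γ : ℝ) (φ κ : Fin N → ℝ)

/-- The dressing matrix `W = (β/2) Y G⁻¹ Y† J`. -/
def darkW (n : ℤ) (s : ℝ) : Matrix (Fin 2) (Fin 2) ℂ :=
  (β / 2 : ℂ) • (darkY a b β γ φ κ n s * (darkG a b β γ φ κ n s)⁻¹ * (darkY a b β γ φ κ n s)ᴴ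
    * sigJ)

/-- The second coefficient of the dressing. -/
def darkT (n : ℤ) (s : ℝ) : Matrix (Fin 2) (Fin 2) ℂ :=
  (β / 2 : ℂ) • (darkY a b β γ φ κ n s * (darkG a b β γ φ κ n s)⁻¹ * darkL a b β γ φ
    * (darkY a b β γ φ κ n s)ᴴ * sigJ)

/-- The dressed lattice coordinate. -/
def darkX (n : ℤ) (s : ℝ) : ℝ :=
  γ / 2 * a * n + β ^ 2 / 8 * s + (Complex.I * darkW a b β γ φ κ n s 0 0).re

theorem darkW_apply_zero (n : ℤ) (s : ℝ) (i : Fin 2) :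
    darkW a b β γ φ κ n s i 0 = (β / 2 : ℂ) * (darkY a b β γ φ κ n s
      * (darkG a b β γ φ κ n s)⁻¹ * (darkY a b β γ φ κ n s)ᴴ) i 0 := by
  rw [darkW, Matrix.smul_apply, Matrix.mul_apply, Fin.sum_univ_two]
  simp [sigJ]

theorem darkW_apply_one (n : ℤ) (s : ℝ) (i : Fin 2) :
    darkW a b β γ φ κ n s i 1 = -((β / 2 : ℂ) * (darkY a b β γ φ κ n s
      * (darkG a b β γ φ κ n s)⁻¹ * (darkY a b β γ φ κ n s)ᴴ) i 1) := by
  rw [darkW, Matrix.smul_apply, Matrix.mul_apply, Fin.sum_univ_two]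
  simp [sigJ]

/-! ### Symmetries and evolution of the dressing matrix, and the determinant formulas -/

section Angles

variable (hφ : ∀ i, 0 < Real.sin (φ i))
include hφ

theorem darkG_inv_conjTranspose (n : ℤ) (s : ℝ) :
    ((darkG a b β γ φ κ n s)⁻¹)ᴴ = -(darkG a b β γ φ κ n s)⁻¹ := by
  have hu := (darkG_det_ne_zero a b β γ φ κ hφ n s).isUnit
  rw [Matrix.conjTranspose_nonsing_inv, darkG_conjTranspose]
  refine Matrix.inv_eq_right_inv ?_
  rw [Matrix.neg_mul, Matrix.mul_neg, neg_neg, Matrix.mul_nonsing_inv _ hu]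

theorem star_dressing_apply (n : ℤ) (s : ℝ) (i j : Fin 2) :
    star ((darkY a b β γ φ κ n s * (darkG a b β γ φ κ n s)⁻¹ * (darkY a b β γ φ κ n s)ᴴ) i j)
      = -(darkY a b β γ φ κ n s * (darkG a b β γ φ κ n s)⁻¹ * (darkY a b β γ φ κ n s)ᴴ) j i := by
  rw [← Matrix.conjTranspose_apply, Matrix.conjTranspose_mul, Matrix.conjTranspose_mul,
    Matrix.conjTranspose_conjTranspose, darkG_inv_conjTranspose a b β γ φ κ hφ, Matrix.neg_mul,
    Matrix.mul_neg, Matrix.neg_apply, Matrix.mul_assoc]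

theorem darkW_zero_one (n : ℤ) (s : ℝ) :
    darkW a b β γ φ κ n s 0 1 = star (darkW a b β γ φ κ n s 1 0) := by
  rw [darkW_apply_zero, darkW_apply_one, star_mul',
    star_dressing_apply _ _ _ _ _ _ hφ]
  simp

/-- `tr W` equals `tr(G⁻¹ (ΛG - GΛ)) = 0` by the Sylvester relation. -/
theorem darkW_one_one (n : ℤ) (s : ℝ) :
    darkW a b β γ φ κ n s 1 1 = -darkW a b β γ φ κ n s 0 0 := by
  have hu := (darkG_det_ne_zero a b β γ φ κ hφ n s).isUnit
  have h : (darkW a b β γ φ κ n s).trace = 0 := by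
    rw [darkW, Matrix.mul_assoc, Matrix.mul_assoc, Matrix.trace_smul, Matrix.trace_mul_comm,
      Matrix.mul_assoc, ← Matrix.trace_smul, ← Matrix.mul_smul,
      ← darkL_commutator a b β γ φ κ hφ, Matrix.mul_sub, Matrix.trace_sub,
      Matrix.nonsing_inv_mul_cancel_left _ _ hu, Matrix.trace_mul_comm,
      Matrix.mul_nonsing_inv_cancel_right _ _ hu, sub_self]
  rw [Matrix.trace_fin_two] at h
  linear_combination h

theorem star_darkW_zero_zero (n : ℤ) (s : ℝ) :
    star (darkW a b β γ φ κ n s 0 0) = -darkW a b β γ φ κ n s 0 0 := by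
  rw [darkW_apply_zero, star_mul', star_dressing_apply _ _ _ _ _ _ hφ]
  simp

/-- `W₀₀` is purely imaginary since `G⁻¹` is anti-Hermitian, so the real part taken in `darkX` loses
nothing. -/
theorem darkX_ofReal (n : ℤ) (s : ℝ) :
    (darkX a b β γ φ κ n s : ℂ)
      = γ / 2 * a * n + β ^ 2 / 8 * s + Complex.I * darkW a b β γ φ κ n s 0 0 := by
  have h : (((Complex.I * darkW a b β γ φ κ n s 0 0).re : ℝ) : ℂ)
      = Complex.I * darkW a b β γ φ κ n s 0 0 := by
    rw [← Complex.conj_eq_iff_re, ← Complex.star_def, star_mul', star_darkW_zero_zero _ _ _ _ _ _ hφ]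
    simp
  rw [darkX, Complex.ofReal_add, h]
  push_cast
  ring

/-- The difference `H - G` has rank one: `(w_i⁻¹ w_j⁻¹ - 1) / (w_i⁻¹ - w_j) = w_j⁻¹`. The matrix
determinant lemma then yields `det H / det G`. -/
theorem darkQ_eq (n : ℤ) (s : ℝ) :
    darkQ a b β γ φ κ n s = seedQ a b β γ n s + darkW a b β γ φ κ n s 1 0 := by
  have hdet := darkG_det_ne_zero a b β γ φ κ hφ n s
  have hE := halfPhase_ne_zero a b γ n s
  set B : Matrix (Fin N) Unit ℂ := Matrix.of fun i _ => amp a b β γ (φ i) (κ i) n s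
  set C : Matrix Unit (Fin N) ℂ := Matrix.of fun _ j =>
    amp a b β γ (φ j) (κ j) n s * (phaseW (φ j))⁻¹
  have hH : darkH a b β γ φ κ n s = darkG a b β γ φ κ n s + B * C := by
    ext i j
    have hi := phaseW_ne_zero (φ i)
    have hj := phaseW_ne_zero (φ j)
    have hd := phaseW_inv_sub_ne_zero (hφ i) (hφ j)
    rw [Matrix.add_apply, darkH_apply, darkG_apply, div_add' _ _ _ hd]
    congr 1
    simp only [B, C, Matrix.mul_apply, Finset.univ_unique, Finset.sum_singleton, Matrix.of_apply]
    field_simp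
    ring
  have hW : darkW a b β γ φ κ n s 1 0
      = (β / 2 : ℂ) * (halfPhase a b γ n s ^ 2 * (C * (darkG a b β γ φ κ n s)⁻¹ * B) () ()) := by
    rw [darkW_apply_zero]
    congr 1
    simp only [Matrix.mul_apply, Finset.mul_sum, Finset.sum_mul]
    refine Finset.sum_congr rfl fun i _ => Finset.sum_congr rfl fun j _ => ?_
    rw [Matrix.conjTranspose_apply]
    simp only [B, C, darkY, Matrix.of_apply, Matrix.cons_val_zero, Matrix.cons_val_one,
      Matrix.cons_val_fin_one]
    rw [star_mul', star_amp, star_inv₀, star_halfPhase, inv_inv]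
    ring
  rw [darkQ, hH, det_add_mul_eq _ _ _ hdet, mul_div_cancel_left₀ _ hdet, hW, seedQ_eq]
  have : Complex.exp (Complex.I * theta a b γ n s) = halfPhase a b γ n s ^ 2 := by
    rw [halfPhase, ← Complex.exp_nat_mul]
    push_cast
    ring_nf
  rw [this]
  ring

/-- Jacobi's formula gives the trace of `Y G⁻¹ Y†`, without `J`. Since `W = (β/2) Y G⁻¹ Y† J` is
traceless, its two diagonal contributions are equal. -/
theorem logDeriv_darkG_det (n : ℤ) (s : ℝ) :
    logDeriv (fun u => (darkG a b β γ φ κ n u).det) s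
      = -(Complex.I / 2 * darkW a b β γ φ κ n s 0 0) := by
  have h1 := darkW_one_one a b β γ φ κ hφ n s
  rw [(hasEntryDerivAt_darkG a b β γ φ κ hφ n s).logDeriv_det_eq_trace_inv, Matrix.mul_smul,
    Matrix.trace_smul, ← Matrix.mul_assoc, Matrix.trace_mul_comm, ← Matrix.mul_assoc,
    Matrix.trace_fin_two, smul_eq_mul]
  rw [darkW_apply_zero, darkW_apply_one] at h1
  rw [darkW_apply_zero]
  linear_combination Complex.I / 4 * h1

theorem darkG_det_differentiableAt (n : ℤ) (s : ℝ) :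
    DifferentiableAt ℝ (fun u => (darkG a b β γ φ κ n u).det) s :=
  (hasEntryDerivAt_darkG a b β γ φ κ hφ n s).det.differentiableAt

theorem logDeriv_darkG_det_div (n : ℤ) (s : ℝ) :
    logDeriv (fun u => (darkG a b β γ φ κ (n + 1) u).det / (darkG a b β γ φ κ n u).det) s
      = -(Complex.I / 2 * (darkW a b β γ φ κ (n + 1) s 0 0 - darkW a b β γ φ κ n s 0 0)) := by
  rw [logDeriv_div s (darkG_det_ne_zero a b β γ φ κ hφ (n + 1) s)
    (darkG_det_ne_zero a b β γ φ κ hφ n s) (darkG_det_differentiableAt a b β γ φ κ hφ (n + 1) s)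
    (darkG_det_differentiableAt a b β γ φ κ hφ n s), logDeriv_darkG_det _ _ _ _ _ _ hφ,
    logDeriv_darkG_det _ _ _ _ _ _ hφ]
  ring

theorem hasEntryDerivAt_darkW (n : ℤ) (s : ℝ) :
    HasEntryDerivAt (darkW a b β γ φ κ n)
      (((Complex.I / 4) • sigJ) * darkT a b β γ φ κ n s
          - darkT a b β γ φ κ n s * ((Complex.I / 4) • sigJ)
        + (seedPot a b β γ n s - (((Complex.I / 4) • sigJ) * darkW a b β γ φ κ n s
          - darkW a b β γ φ κ n s * ((Complex.I / 4) • sigJ))) * darkW a b β γ φ κ n s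
        - darkW a b β γ φ κ n s * seedPot a b β γ n s) s := by
  have hL : (darkL a b β γ φ)ᴴ = darkL a b β γ φ := by
    rw [darkL, Matrix.diagonal_conjTranspose]
    congr 1
    funext i
    rw [Pi.star_apply, seedLam_phaseW, Complex.star_def, Complex.conj_ofReal]
  have h := hasEntryDerivAt_dressing (fun u => darkG_det_ne_zero a b β γ φ κ hφ n u) hL
    sigJ_conjTranspose (seedPot_conjTranspose a b β γ n s) sigJ_sq (seedPot_mul_sigJ a b β γ n s)
    (darkL_commutator a b β γ φ κ hφ n s) (hasEntryDerivAt_darkG a b β γ φ κ hφ n s)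
    (hasEntryDerivAt_darkY a b β γ φ κ n s)
  change HasEntryDerivAt (darkW a b β γ φ κ n)
    ((Complex.I / 4) • (sigJ * darkT a b β γ φ κ n s - darkT a b β γ φ κ n s * sigJ)
      + (seedPot a b β γ n s - (Complex.I / 4) • (sigJ * darkW a b β γ φ κ n s
        - darkW a b β γ φ κ n s * sigJ)) * darkW a b β γ φ κ n s
      - darkW a b β γ φ κ n s * seedPot a b β γ n s) s at h
  refine h.congr_deriv ?_
  simp only [smul_sub, Matrix.smul_mul, Matrix.mul_smul]

theorem hasDerivAt_darkX (n : ℤ) (s : ℝ) :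
    HasDerivAt (darkX a b β γ φ κ n) (‖darkQ a b β γ φ κ n s‖ ^ 2 / 2) s := by
  have h1 := (hasEntryDerivAt_darkW a b β γ φ κ hφ n s 0 0).const_mul Complex.I
  have h2 : HasDerivAt (fun u : ℝ => (Complex.I * darkW a b β γ φ κ n u 0 0).re) _ s :=
    Complex.reCLM.hasFDerivAt.comp_hasDerivAt s h1
  have h3 : HasDerivAt (fun u : ℝ => γ / 2 * a * n + β ^ 2 / 8 * u) (β ^ 2 / 8) s := by
    simpa using ((hasDerivAt_id s).const_mul (β ^ 2 / 8)).const_add (γ / 2 * a * n)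
  refine (h3.add h2).congr_deriv ?_
  rw [← Complex.ofReal_inj, Complex.reCLM_apply]
  have h4 : ((‖darkQ a b β γ φ κ n s‖ ^ 2 / 2 : ℝ) : ℂ)
      = star (darkQ a b β γ φ κ n s) * darkQ a b β γ φ κ n s / 2 := by
    rw [Complex.star_def, ← Complex.normSq_eq_conj_mul_self, Complex.normSq_eq_norm_sq]
    push_cast
    ring
  have h5 : star (seedQ a b β γ n s) * seedQ a b β γ n s = β ^ 2 / 4 := by
    have hE := halfPhase_ne_zero a b γ n s
    rw [star_seedQ, seedQ_eq]
    field_simp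
    norm_num
  -- In the upper left entry the commutator of the diagonal matrix `j` with `T` vanishes; the terms
  -- in `W₁₀` and its conjugate complete the square `|q^{[0]} + W₁₀|²`.
  have h6 : (Complex.I * (((Complex.I / 4) • sigJ) * darkT a b β γ φ κ n s
          - darkT a b β γ φ κ n s * ((Complex.I / 4) • sigJ)
        + (seedPot a b β γ n s - (((Complex.I / 4) • sigJ) * darkW a b β γ φ κ n s
          - darkW a b β γ φ κ n s * ((Complex.I / 4) • sigJ))) * darkW a b β γ φ κ n s
        - darkW a b β γ φ κ n s * seedPot a b β γ n s) 0 0)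
      = ((‖darkQ a b β γ φ κ n s‖ ^ 2 / 2 - β ^ 2 / 8 : ℝ) : ℂ) := by
    rw [Complex.ofReal_sub, h4, darkQ_eq _ _ _ _ _ _ hφ, star_add]
    simp only [Matrix.sub_apply, Matrix.add_apply, Matrix.mul_apply, Fin.sum_univ_two,
      Matrix.smul_apply, smul_eq_mul, darkW_zero_one _ _ _ _ _ _ hφ]
    generalize darkW a b β γ φ κ n s 1 0 = σ
    generalize darkW a b β γ φ κ n s 0 0 = τ
    simp only [seedPot, sigJ, Matrix.of_apply, Matrix.cons_val_zero, Matrix.cons_val_one,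
      Matrix.cons_val', Matrix.cons_val_fin_one]
    generalize hq : star (seedQ a b β γ n s) = q' at *
    generalize star σ = σ'
    push_cast
    linear_combination (-(1 / 2) * (q' * σ + σ' * seedQ a b β γ n s + σ' * σ)) * Complex.I_sq
      - 1 / 2 * h5
  rw [h6, Complex.ofReal_re]
  push_cast
  ring

/-! ### Zero curvature of the dressed fields -/

section Shift

variable (hs : Real.sin (b / 2) ≠ 0) (hr : ∀ i, 0 < growthRatio a b β γ (φ i))
include hs hr

/-- The discrete counterpart of the evolution of `W`: it expresses `T_{n+1} - T_n` through `W`,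
which is what lets `T` be eliminated from the zero-curvature equation. -/
theorem dark_second_shift (n : ℤ) (s : ℝ) :
    darkT a b β γ φ κ (n + 1) s = darkT a b β γ φ κ n s
      + (seedA a b β γ n s + darkW a b β γ φ κ (n + 1) s - darkW a b β γ φ κ n s)
        * darkW a b β γ φ κ n s - darkW a b β γ φ κ (n + 1) s * seedA a b β γ n s := by
  have hY := darkY_shift a b β γ φ κ hs hr n s
  set D := Matrix.diagonal (fun i => (darkMu a b β γ (φ i) : ℂ)) with hD
  have hDD' : D * Matrix.diagonal (fun i => (darkMu a b β γ (φ i) : ℂ)⁻¹) = 1 := by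
    rw [hD, Matrix.diagonal_mul_diagonal, ← Matrix.diagonal_one]
    congr 1
    funext i
    exact mul_inv_cancel₀ (darkMu_ne_zero a b β γ φ hs hr i)
  have hDL : D * darkL a b β γ φ = darkL a b β γ φ * D := by
    rw [hD, darkL, Matrix.diagonal_mul_diagonal, Matrix.diagonal_mul_diagonal]
    simp only [mul_comm]
  have hDs : Dᴴ = D := by
    rw [hD, Matrix.diagonal_conjTranspose]
    congr 1
    funext i
    rw [Pi.star_apply, Complex.star_def, Complex.conj_ofReal]
  have hLs : (darkL a b β γ φ)ᴴ = darkL a b β γ φ := by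
    rw [darkL, Matrix.diagonal_conjTranspose]
    congr 1
    funext i
    rw [Pi.star_apply, seedLam_phaseW, Complex.star_def, Complex.conj_ofReal]
  have hZ : D * (darkY a b β γ φ κ (n + 1) s)ᴴ * sigJ
      = darkL a b β γ φ * (darkY a b β γ φ κ n s)ᴴ * sigJ
        - (darkY a b β γ φ κ n s)ᴴ * sigJ * seedA a b β γ n s := by
    have h := congrArg Matrix.conjTranspose hY
    rw [Matrix.conjTranspose_mul, Matrix.conjTranspose_add, Matrix.conjTranspose_mul,
      Matrix.conjTranspose_mul, hDs, hLs] at h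
    rw [h, Matrix.add_mul, Matrix.mul_assoc _ (seedA a b β γ n s)ᴴ, seedA_conjTranspose_mul_sigJ,
      Matrix.mul_neg, ← sub_eq_add_neg, Matrix.mul_assoc _ sigJ]
  have hDD := darkMu_mul_darkMu a b β γ φ hs hr
  have hB := dressed_shift (darkG_det_ne_zero a b β γ φ κ hφ n s).isUnit
    (darkG_det_ne_zero a b β γ φ κ hφ (n + 1) s).isUnit hDD'
    (darkL_commutator a b β γ φ κ hφ n s) hY hZ hDD (darkG_shift a b β γ φ κ hs hr hφ n s)
  have h := dressed_shift_second (k := (β / 2 : ℂ)) hDD' hDL hZ hDD (seedA_sq hs n s) hB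
  rw [darkT, darkT, darkW, darkW]
  rw [← h]
  abel

/-- The lower left entry of the dressed zero-curvature equation. The dressed `A` has diagonal
entries `∓i (x_{n+1} - x_n)`, and `Q - [j, W]` has lower left entry `(i/2) q`; the seed enters only
through the same entry. -/
theorem hasDerivAt_darkQ_sub (n : ℤ) (s : ℝ) :
    HasDerivAt (fun u => darkQ a b β γ φ κ (n + 1) u - darkQ a b β γ φ κ n u)
      ((1 / 2 : ℂ) * ((darkX a b β γ φ κ (n + 1) s - darkX a b β γ φ κ n s : ℝ) : ℂ)
        * (darkQ a b β γ φ κ (n + 1) s + darkQ a b β γ φ κ n s)) s := by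
  have h1 := (hasDerivAt_seedQ a b β γ (n + 1) s).sub (hasDerivAt_seedQ a b β γ n s)
  have h2 := hasEntryDerivAt_darkW a b β γ φ κ hφ n s 1 0
  have h3 := hasEntryDerivAt_darkW a b β γ φ κ hφ (n + 1) s 1 0
  have h4 : (fun u => darkQ a b β γ φ κ (n + 1) u - darkQ a b β γ φ κ n u)
      = fun u => (seedQ a b β γ (n + 1) u - seedQ a b β γ n u)
        + darkW a b β γ φ κ (n + 1) u 1 0 - darkW a b β γ φ κ n u 1 0 := by
    funext u
    rw [darkQ_eq _ _ _ _ _ _ hφ, darkQ_eq _ _ _ _ _ _ hφ]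
    ring
  rw [h4]
  refine ((h1.add h3).sub h2).congr_deriv ?_
  have h5 := seed_zeroCurvature_apply (a := a) (β := β) (γ := γ) hs n s
  have h6 := dressed_zeroCurvature (seedPot_succ a b β γ n s)
    (dark_second_shift a b β γ φ κ hφ hs hr n s)
  have h7 := congrFun (congrFun h6 1) 0
  rw [Matrix.sub_apply, Matrix.add_apply, h5] at h7
  rw [mul_assoc, mul_assoc, ← mul_sub, ← mul_sub, ← mul_assoc]
  refine h7.trans ?_
  rw [Complex.ofReal_sub, darkX_ofReal _ _ _ _ _ _ hφ, darkX_ofReal _ _ _ _ _ _ hφ,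
    darkQ_eq _ _ _ _ _ _ hφ, darkQ_eq _ _ _ _ _ _ hφ]
  simp only [Matrix.sub_apply, Matrix.add_apply, Matrix.mul_apply, Fin.sum_univ_two,
    Matrix.smul_apply, smul_eq_mul, darkW_one_one _ _ _ _ _ _ hφ]
  simp only [seedPot, sigJ, seedA, Matrix.of_apply, Matrix.cons_val_zero, Matrix.cons_val_one,
    Matrix.cons_val', Matrix.cons_val_fin_one]
  generalize darkW a b β γ φ κ n s 1 0 = σ
  generalize darkW a b β γ φ κ (n + 1) s 1 0 = σ₁
  generalize darkW a b β γ φ κ n s 0 0 = τ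
  generalize darkW a b β γ φ κ (n + 1) s 0 0 = τ₁
  generalize seedQ a b β γ n s = q
  generalize seedQ a b β γ (n + 1) s = q₁
  push_cast
  linear_combination (-(1 / 4) * a * γ * (q + σ + q₁ + σ₁)) * Complex.I_sq

end Shift

end Angles

end Dressed

/-- The coupled system implies the scalar equation in the time `t = -s`. -/
theorem IsCoupledSolution.satisfiesScalarEquation {q : ℤ → ℝ → ℂ} {x : ℤ → ℝ → ℝ}
    (h : IsCoupledSolution (-1) q x) (hx : ∀ n s, HasDerivAt (x n) (‖q n s‖ ^ 2 / 2) s) :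
    SatisfiesScalarEquation (-1) (fun n t => q n (-t)) (fun n t => x n (-t)) := by
  intro n t hn _
  obtain ⟨hq, -, heq⟩ := h
  have h1 : HasDerivAt (fun u => q (n + 1) u - q n u)
      ((1 / 2 : ℂ) * ((x (n + 1) (-t) - x n (-t) : ℝ) : ℂ) * (q (n + 1) (-t) + q n (-t))) (-t) := by
    rw [← (heq n (-t)).1]
    exact ((hq (n + 1)).sub (hq n) (-t)).hasDerivAt
  have h2 : HasDerivAt (fun u : ℝ => -u) (-1) t := hasDerivAt_neg t
  have h3 := (((hx (n + 1) (-t)).sub (hx n (-t))).ofReal_comp)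
  have hn' : ((x (n + 1) (-t) - x n (-t) : ℝ) : ℂ) ≠ 0 := by exact_mod_cast hn
  have h4 := HasDerivAt.scomp t (h1.div h3 hn') h2
  have h5 : deriv (slope (fun n t => q n (-t)) (fun n t => x n (-t)) n) t = _ := h4.deriv
  have h6 := (HasDerivAt.scomp t (hx (n + 1) (-t)) h2).deriv
  have h7 : deriv (fun t => x (n + 1) (-t)) t = _ := h6
  -- After the quotient rule, the two terms `|q_{n+1}|² D_n / (2 Δx_n)`, one from the derivative of
  -- the mesh width and one from convection, cancel.
  rw [fixedPositionDeriv, h5, h7]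
  simp only [slope, smul_eq_mul, Complex.real_smul]
  simp only [Pi.sub_apply, Complex.ofReal_sub, Complex.ofReal_neg, Complex.ofReal_one,
    Complex.ofReal_div, Complex.ofReal_pow, Complex.ofReal_ofNat, Complex.ofReal_mul] at hn' ⊢
  field_simp
  ring

/-! ### Eigenvectors at non-real spectral parameters -/

section Curve

/-- The uniformizing parameter `w = (c + λ + ξ)/β` of the spectral curve. -/
def curveW (a b β γ : ℝ) (p : ℂ × ℂ) : ℂ := (seedC a b γ + (p.1 + p.2)) / β

variable {a b β γ : ℝ} {p : ℂ × ℂ}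

theorem curve_mul (hp : p ∈ spectralCurve a b β γ) :
    (seedC a b γ + (p.1 + p.2)) * (seedC a b γ + (p.1 - p.2)) = (β : ℂ) ^ 2 := by
  linear_combination -hp.1

theorem div_curve_add : β / (seedC a b γ + (p.1 + p.2)) = (curveW a b β γ p)⁻¹ := by
  rw [curveW, inv_div]

theorem eigenvector_zero (κ : ℝ) (α : ℂ) (n : ℤ) (s : ℝ) :
    eigenvector a b β γ κ α p n s 0 = (halfPhase a b γ n s)⁻¹ *
      (Complex.exp (omega a b γ κ p n s)
        + α * (star p.1 - p.1) * (Complex.exp (omega a b γ κ p n s))⁻¹) := by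
  simp [eigenvector, Matrix.mulVec, dotProduct, Fin.sum_univ_two, Matrix.mul_apply, halfPhase,
    Complex.exp_neg]
  ring

theorem hasDerivAt_exp_omega (κ : ℝ) (n : ℤ) (s : ℝ) :
    HasDerivAt (fun u => Complex.exp (omega a b γ κ p n u))
      (Complex.I / 4 * p.2 * Complex.exp (omega a b γ κ p n s)) s := by
  have h : HasDerivAt (fun u => omega a b γ κ p n u) (Complex.I / 4 * p.2) s := by
    have h1 : HasDerivAt (fun u : ℝ => (u : ℂ)) 1 s := by
      simpa using (hasDerivAt_id s).ofReal_comp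
    simp only [omega]
    exact (((h1.const_mul (Complex.I / 4 * p.2)).add_const _).add_const _).congr_deriv (mul_one _)
  refine h.cexp.congr_deriv (mul_comm _ _)

variable (hβ : 0 < β) (hp : p ∈ spectralCurve a b β γ)
include hβ hp
theorem curveW_ne_zero : curveW a b β γ p ≠ 0 := by
  have hβ' : (β : ℂ) ≠ 0 := by exact_mod_cast hβ.ne'
  refine div_ne_zero (fun h => ?_) hβ'
  have := curve_mul hp
  rw [h, zero_mul] at this
  exact pow_ne_zero 2 hβ' this.symm

theorem curveW_inv : (curveW a b β γ p)⁻¹ = (seedC a b γ + (p.1 - p.2)) / β := by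
  have hβ' : (β : ℂ) ≠ 0 := by exact_mod_cast hβ.ne'
  refine inv_eq_of_mul_eq_one_right ?_
  rw [curveW, div_mul_div_comm, curve_mul hp]
  field_simp

theorem seedLam_curveW : seedLam a b β γ (curveW a b β γ p) = p.1 := by
  have hβ' : (β : ℂ) ≠ 0 := by exact_mod_cast hβ.ne'
  rw [seedLam, curveW_inv hβ hp, curveW]
  field_simp
  ring

theorem curveW_sub_inv : β / 2 * (curveW a b β γ p - (curveW a b β γ p)⁻¹) = p.2 := by
  have hβ' : (β : ℂ) ≠ 0 := by exact_mod_cast hβ.ne'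
  rw [curveW_inv hβ hp, curveW]
  field_simp
  ring

theorem div_curve_sub : β / (seedC a b γ + (p.1 - p.2)) = curveW a b β γ p := by
  rw [← inv_inv (curveW a b β γ p), curveW_inv hβ hp, inv_div]

theorem eigenvector_one (κ : ℝ) (α : ℂ) (n : ℤ) (s : ℝ) :
    eigenvector a b β γ κ α p n s 1 = halfPhase a b γ n s *
      ((curveW a b β γ p)⁻¹ * Complex.exp (omega a b γ κ p n s)
        + α * (star p.1 - p.1) * curveW a b β γ p * (Complex.exp (omega a b γ κ p n s))⁻¹) := by
  simp [eigenvector, Matrix.mulVec, dotProduct, Fin.sum_univ_two, Matrix.mul_apply, halfPhase,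
    Complex.exp_neg, div_curve_add, div_curve_sub hβ hp]
  ring

/-- The eigenvectors satisfy the temporal part of the Lax pair. -/
theorem hasDerivAt_eigenvector (κ : ℝ) (α : ℂ) (n : ℤ) (s : ℝ) :
    HasDerivAt (eigenvector a b β γ κ α p n)
      (laxV (-1) (seedQ a b β γ) p.1 n s *ᵥ eigenvector a b β γ κ α p n s) s := by
  have hw := curveW_ne_zero hβ hp
  have hE := halfPhase_ne_zero a b γ n s
  have he := Complex.exp_ne_zero (omega a b γ κ p n s)
  have h1 := hasDerivAt_exp_omega (a := a) (b := b) (γ := γ) (p := p) κ n s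
  have h2 := h1.inv he
  have h3 := hasDerivAt_halfPhase a b γ n s
  have hl := seedLam_curveW hβ hp
  have hx := curveW_sub_inv hβ hp
  rw [hasDerivAt_pi]
  intro i
  fin_cases i
  · have h := (h3.inv hE).mul (h1.add (h2.const_mul (α * (star p.1 - p.1))))
    simp only [Fin.zero_eta, eigenvector_zero]
    refine h.congr_deriv ?_
    rw [Matrix.mulVec, dotProduct, Fin.sum_univ_two, eigenvector_zero, eigenvector_one hβ hp,
      laxV, star_seedQ]
    simp only [Matrix.of_apply, Matrix.cons_val_zero, Matrix.cons_val_one, Matrix.cons_val',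
      Matrix.cons_val_fin_one, Pi.add_apply, Pi.inv_apply]
    rw [← hx]
    -- The conjugate of `λ` enters only through the coefficient of the second exponential; it is
    -- frozen before `λ` is expressed by `w`.
    generalize star p.1 = l'
    rw [← hl, seedLam]
    generalize Complex.exp (omega a b γ κ p n s) = e at *
    field_simp
    push_cast
    ring
  · have h := h3.mul ((h1.const_mul (curveW a b β γ p)⁻¹).add
      (h2.const_mul (α * (star p.1 - p.1) * curveW a b β γ p)))
    simp only [Fin.mk_one, eigenvector_one hβ hp]
    refine h.congr_deriv ?_
    rw [Matrix.mulVec, dotProduct, Fin.sum_univ_two, eigenvector_zero, eigenvector_one hβ hp,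
      laxV, seedQ_eq]
    simp only [Matrix.of_apply, Matrix.cons_val_zero, Matrix.cons_val_one, Matrix.cons_val',
      Matrix.cons_val_fin_one, Pi.add_apply, Pi.inv_apply]
    rw [← hx]
    generalize star p.1 = l'
    rw [← hl, seedLam]
    generalize Complex.exp (omega a b γ κ p n s) = e at *
    field_simp
    ring

variable (hs : Real.sin (b / 2) ≠ 0)
include hs

theorem omega_numerator :
    Real.sin (b / 2) * (Complex.I * a * γ / 2 - p.2) + Complex.I * Real.cos (b / 2) * p.1
      = Complex.I * seedMult a b β γ (curveW a b β γ p) := by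
  have hw := curveW_ne_zero hβ hp
  have hz := phaseW_ne_zero (b / 2)
  nth_rewrite 1 [← seedLam_curveW hβ hp]
  nth_rewrite 1 [← curveW_sub_inv hβ hp]
  rw [seedLam, seedMult, sin_eq_phaseW, cos_eq_phaseW, seedC_eq hs, seed_aγ_eq hs]
  field_simp
  ring

theorem omega_denominator :
    Real.sin (b / 2) * (Complex.I * a * γ / 2 + p.2) + Complex.I * Real.cos (b / 2) * p.1
      = Complex.I * seedMult a b β γ (curveW a b β γ p)⁻¹ := by
  have hw := curveW_ne_zero hβ hp
  have hz := phaseW_ne_zero (b / 2)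
  nth_rewrite 1 [← seedLam_curveW hβ hp]
  nth_rewrite 1 [← curveW_sub_inv hβ hp]
  rw [seedLam, seedMult, sin_eq_phaseW, cos_eq_phaseW, seedC_eq hs, seed_aγ_eq hs]
  field_simp
  ring

theorem omega_eq (κ : ℝ) (n : ℤ) (s : ℝ) :
    omega a b γ κ p n s = Complex.I / 4 * p.2 * s
      + (n : ℂ) / 2 * Complex.log (seedMult a b β γ (curveW a b β γ p)
        / seedMult a b β γ (curveW a b β γ p)⁻¹) + κ := by
  rw [omega, omega_numerator hβ hp hs, omega_denominator hβ hp hs,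
    mul_div_mul_left _ _ Complex.I_ne_zero]

/-- Up to a factor depending on `n` only, the eigenvectors solve the Lax pair of the seed. -/
theorem exists_isLaxSolution (h1 : seedMult a b β γ (curveW a b β γ p) ≠ 0)
    (h2 : seedMult a b β γ (curveW a b β γ p)⁻¹ ≠ 0) (κ : ℝ) (α : ℂ) :
    ∃ f : ℤ → ℂ, (∀ n, f n ≠ 0) ∧ IsLaxSolution (-1) a (seedQ a b β γ) (seedRho γ) p.1
      (fun n s => f n • eigenvector a b β γ κ α p n s) := by
  have hw := curveW_ne_zero hβ hp
  have hz := phaseW_ne_zero (b / 2)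
  have hl : p.1 ≠ 0 := fun h => hp.2 (by rw [h, Complex.zero_im])
  set n₁ := seedMult a b β γ (curveW a b β γ p) with hn₁
  set n₂ := seedMult a b β γ (curveW a b β γ p)⁻¹ with hn₂
  set g := Complex.exp (1 / 2 * Complex.log (n₁ / n₂)) with hg
  have hg0 : g ≠ 0 := Complex.exp_ne_zero _
  have hg2 : g * g * n₂ = n₁ := by
    rw [hg, ← Complex.exp_add, ← add_mul, add_halves, one_mul, Complex.exp_log (div_ne_zero h1 h2)]
    field_simp
  have hgs : ∀ n s, Complex.exp (omega a b γ κ p (n + 1) s)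
      = Complex.exp (omega a b γ κ p n s) * g := by
    intro n s
    rw [omega_eq hβ hp hs, omega_eq hβ hp hs, hg, ← Complex.exp_add]
    congr 1
    push_cast
    ring
  have hν : n₁ / (p.1 * g) ≠ 0 := div_ne_zero h1 (mul_ne_zero hl hg0)
  -- `λ U_n` multiplies the two exponential branches by `n₁` and `n₂`, up to the half phases, while
  -- `e^{±ω}` gains only `g^{±1}`. Since `g² = n₁/n₂` for any branch of the logarithm, `n₁/g = n₂ g`
  -- is a common missing factor; division by `λ` passes from `λ U_n` to `U_n`.
  refine ⟨fun n => (n₁ / (p.1 * g)) ^ n, fun n => zpow_ne_zero n hν, fun n s => ⟨?_, ?_⟩⟩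
  · have hE := halfPhase_ne_zero a b γ n s
    have he := Complex.exp_ne_zero (omega a b γ κ p n s)
    have e1 := seed_shift_fst (a := a) (β := β) (γ := γ) hs hw
    have e2 := seed_shift_snd (a := a) (β := β) (γ := γ) hs hw
    have e3 := seed_shift_fst (a := a) (β := β) (γ := γ) hs (inv_ne_zero hw)
    have e4 := seed_shift_snd (a := a) (β := β) (γ := γ) hs (inv_ne_zero hw)
    have hsym : seedLam a b β γ (curveW a b β γ p)⁻¹ = seedLam a b β γ (curveW a b β γ p) := by
      rw [seedLam, seedLam, inv_inv, add_comm (curveW a b β γ p)⁻¹]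
    rw [hsym] at e3 e4
    rw [seedLam_curveW hβ hp] at e1 e2 e3 e4
    rw [← hn₁] at e1 e2
    rw [← hn₂, inv_inv] at e3 e4
    beta_reduce
    rw [Matrix.mulVec_smul, zpow_add_one₀ hν, mul_smul]
    congr 1
    funext i
    rw [Pi.smul_apply, smul_eq_mul, Matrix.mulVec, dotProduct, Fin.sum_univ_two,
      eigenvector_zero, eigenvector_one hβ hp, laxU, star_seedQ, star_seedQ, seedQ_eq,
      seedQ_eq, halfPhase_succ]
    generalize hε : α * (star p.1 - p.1) = ε
    generalize hee : Complex.exp (omega a b γ κ p n s) = e at he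
    fin_cases i
    · simp only [Fin.zero_eta, eigenvector_zero, Matrix.of_apply, Matrix.cons_val_zero,
        Matrix.cons_val_one, Matrix.cons_val', Matrix.cons_val_fin_one, halfPhase_succ, hgs, seedRho,
        hε, hee]
      have t1 : n₁ / (p.1 * g) * ((halfPhase a b γ n s * phaseW (b / 2))⁻¹ * (e * g + ε * (e * g)⁻¹))
          = (halfPhase a b γ n s)⁻¹ / p.1 * (e * ((phaseW (b / 2))⁻¹ * n₁)
            + ε * e⁻¹ * ((phaseW (b / 2))⁻¹ * n₂)) := by
        rw [← hg2]
        field_simp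
      rw [t1, ← e1, ← e3]
      push_cast
      field_simp
      ring
    · simp only [Fin.mk_one, eigenvector_one hβ hp, Matrix.of_apply, Matrix.cons_val_zero,
        Matrix.cons_val_one, Matrix.cons_val', Matrix.cons_val_fin_one, halfPhase_succ, hgs, seedRho,
        hε, hee]
      have t1 : n₁ / (p.1 * g) * (halfPhase a b γ n s * phaseW (b / 2)
            * ((curveW a b β γ p)⁻¹ * (e * g) + ε * curveW a b β γ p * (e * g)⁻¹))
          = halfPhase a b γ n s / p.1 * (e * (phaseW (b / 2) * n₁ * (curveW a b β γ p)⁻¹)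
            + ε * e⁻¹ * (phaseW (b / 2) * n₂ * curveW a b β γ p)) := by
        rw [← hg2]
        field_simp
      rw [t1, ← e2, ← e4]
      push_cast
      field_simp
      ring
  · rw [Matrix.mulVec_smul]
    exact (hasDerivAt_eigenvector hβ hp κ α n s).const_smul ((n₁ / (p.1 * g)) ^ n)

end Curve

/-! ### The limit of real spectral parameters -/

section SingleLimit

variable {a b β γ φ : ℝ} {X : Type*} {F : Filter X} {p : X → ℂ × ℂ} (hβ : 0 < β)
  (ht : Filter.Tendsto p F (nhds (realPoint a b β γ φ)))

include ht in
theorem tendsto_lam :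
    Filter.Tendsto (fun x => (p x).1) F (nhds (seedLam a b β γ (phaseW φ))) := by
  have h := (continuous_fst.tendsto _).comp ht
  rw [seedLam_phaseW]
  exact h

include ht in
theorem tendsto_star_lam :
    Filter.Tendsto (fun x => star (p x).1) F (nhds (seedLam a b β γ (phaseW φ))) := by
  have h := (tendsto_lam ht).star
  rwa [seedLam_phaseW, Complex.star_def, Complex.conj_ofReal, ← seedLam_phaseW] at h

include ht in
theorem tendsto_lam_sub :
    Filter.Tendsto (fun x => star (p x).1 - (p x).1) F (nhds 0) := by
  simpa using (tendsto_star_lam ht).sub (tendsto_lam ht)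

include hβ ht in
theorem tendsto_curveW :
    Filter.Tendsto (fun x => curveW a b β γ (p x)) F (nhds (phaseW φ)) := by
  have hc : Continuous (curveW a b β γ) := by
    unfold curveW
    fun_prop
  have h := (hc.tendsto _).comp ht
  have h1 : curveW a b β γ (realPoint a b β γ φ) = phaseW φ := by
    have hβ' : (β : ℂ) ≠ 0 := by exact_mod_cast hβ.ne'
    rw [curveW, realPoint, phaseW, mul_comm Complex.I (φ : ℂ), Complex.exp_mul_I]
    push_cast
    field_simp
    ring
  rw [h1] at h
  exact h

theorem continuousAt_seedMult {w : ℂ} (hw : w ≠ 0) : ContinuousAt (seedMult a b β γ) w := by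
  have hz := phaseW_ne_zero (b / 2)
  unfold seedMult
  exact continuousAt_const.add (continuousAt_const.mul ((continuousAt_const.mul continuousAt_id).add
    ((continuousAt_const.mul continuousAt_id).inv₀ (mul_ne_zero hz hw))))

include hβ ht in
theorem tendsto_seedMult :
    Filter.Tendsto (fun x => seedMult a b β γ (curveW a b β γ (p x))) F
      (nhds (seedMult a b β γ (phaseW φ))) :=
  (continuousAt_seedMult (phaseW_ne_zero φ)).tendsto.comp (tendsto_curveW hβ ht)

include hβ ht in
theorem tendsto_seedMult_inv :
    Filter.Tendsto (fun x => seedMult a b β γ (curveW a b β γ (p x))⁻¹) F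
      (nhds (seedMult a b β γ (phaseW φ)⁻¹)) :=
  (continuousAt_seedMult (inv_ne_zero (phaseW_ne_zero φ))).tendsto.comp
    ((tendsto_curveW hβ ht).inv₀ (phaseW_ne_zero φ))

variable (hs : Real.sin (b / 2) ≠ 0) (hr : 0 < growthRatio a b β γ φ)

include hs in
theorem seedMult_div :
    seedMult a b β γ (phaseW φ) / seedMult a b β γ (phaseW φ)⁻¹ = growthRatio a b β γ φ := by
  rw [← phaseW_neg, seedMult_phaseW a b β γ hs, seedMult_phaseW a b β γ hs, ← Complex.ofReal_div,
    growthRatio, div_div_div_cancel_right₀ (mul_ne_zero two_ne_zero hs), ← sub_eq_add_neg]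

include hs hr in
theorem seedMult_phaseW_ne_zero :
    seedMult a b β γ (phaseW φ) ≠ 0 ∧ seedMult a b β γ (phaseW φ)⁻¹ ≠ 0 := by
  have h := seedMult_div (a := a) (β := β) (γ := γ) (φ := φ) hs
  have h' : (growthRatio a b β γ φ : ℂ) ≠ 0 := by exact_mod_cast hr.ne'
  rw [← h] at h'
  exact div_ne_zero_iff.mp h'

variable (hc : ∀ᶠ x in F, p x ∈ spectralCurve a b β γ)
include hβ ht hs hr hc

theorem eventually_exists_isLaxSolution (κ : ℝ) (α : ℂ) :
    ∀ᶠ x in F, ∃ f : ℤ → ℂ, (∀ n, f n ≠ 0) ∧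
      IsLaxSolution (-1) a (seedQ a b β γ) (seedRho γ) (p x).1
        (fun n s => f n • eigenvector a b β γ κ α (p x) n s) := by
  obtain ⟨h1, h2⟩ := seedMult_phaseW_ne_zero hs hr
  filter_upwards [hc, (tendsto_seedMult hβ ht).eventually_ne h1,
    (tendsto_seedMult_inv hβ ht).eventually_ne h2] with x hx hx1 hx2
  exact exists_isLaxSolution hβ hx hs hx1 hx2 κ α

/-- The argument of the logarithm tends to the positive number `growthRatio`, where the principal
branch is continuous. -/
theorem tendsto_exp_omega (κ : ℝ) (n : ℤ) (s : ℝ) :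
    Filter.Tendsto (fun x => Complex.exp (omega a b γ κ (p x) n s)) F
      (nhds (amp a b β γ φ κ n s)) := by
  obtain ⟨h1, h2⟩ := seedMult_phaseW_ne_zero hs hr
  have hlim : Filter.Tendsto (fun x => Complex.I / 4 * (p x).2 * s
      + (n : ℂ) / 2 * Complex.log (seedMult a b β γ (curveW a b β γ (p x))
        / seedMult a b β γ (curveW a b β γ (p x))⁻¹) + κ) F
      (nhds (Complex.I / 4 * (realPoint a b β γ φ).2 * s
        + (n : ℂ) / 2 * Complex.log (growthRatio a b β γ φ) + κ)) := by
    have e1 := (continuous_snd.tendsto _).comp ht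
    have e2 := (tendsto_seedMult hβ ht).div (tendsto_seedMult_inv hβ ht) h2
    rw [seedMult_div hs] at e2
    exact ((((e1.const_mul (Complex.I / 4)).mul_const (s : ℂ)).add
      ((e2.clog (Complex.ofReal_mem_slitPlane.mpr hr)).const_mul ((n : ℂ) / 2))).add_const (κ : ℂ))
  have hval : Complex.I / 4 * (realPoint a b β γ φ).2 * s
        + (n : ℂ) / 2 * Complex.log (growthRatio a b β γ φ) + κ = Z a b β γ φ κ n s := by
    rw [← Complex.ofReal_log hr.le, Z, realPoint]
    push_cast
    linear_combination (β * Complex.sin φ * s / 4) * Complex.I_sq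
  rw [hval] at hlim
  refine (hlim.cexp).congr' ?_
  filter_upwards [hc] with x hx
  rw [omega_eq hβ hx hs]

theorem tendsto_eigenvector_zero (κ : ℝ) (α : ℂ) (n : ℤ) (s : ℝ) :
    Filter.Tendsto (fun x => eigenvector a b β γ κ α (p x) n s 0) F
      (nhds ((halfPhase a b γ n s)⁻¹ * amp a b β γ φ κ n s)) := by
  have h1 := tendsto_exp_omega hβ ht hs hr hc κ n s
  have h2 := (h1.add (((tendsto_lam_sub ht).const_mul α).mul
    (h1.inv₀ (Complex.exp_ne_zero _)))).const_mul (halfPhase a b γ n s)⁻¹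
  rw [mul_zero, zero_mul, add_zero] at h2
  simpa only [eigenvector_zero] using h2

theorem tendsto_eigenvector_one (κ : ℝ) (α : ℂ) (n : ℤ) (s : ℝ) :
    Filter.Tendsto (fun x => eigenvector a b β γ κ α (p x) n s 1) F
      (nhds (halfPhase a b γ n s * amp a b β γ φ κ n s * (phaseW φ)⁻¹)) := by
  have h1 := tendsto_exp_omega hβ ht hs hr hc κ n s
  have hw := tendsto_curveW hβ ht
  have h2 := (((hw.inv₀ (phaseW_ne_zero φ)).mul h1).add
    ((((tendsto_lam_sub ht).const_mul α).mul hw).mul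
      (h1.inv₀ (Complex.exp_ne_zero _)))).const_mul (halfPhase a b γ n s)
  rw [mul_zero, zero_mul, zero_mul, add_zero] at h2
  rw [mul_assoc, mul_comm (amp a b β γ φ κ n s)]
  refine h2.congr' ?_
  filter_upwards [hc] with x hx
  rw [eigenvector_one hβ hx]

/-- With `δ = conj λ - λ`, `V = conj w` and `W = w`, one has `δ = (β/2) (V - W) (1 - V⁻¹ W⁻¹)`.
Divided by `δ`, the leading term of `y†Jy` becomes `(2/β) |e^ω|² / (V - W)`, the two cross terms
lose their factor `δ`, and the term in `|α|²` still vanishes in the limit. -/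
theorem tendsto_diagonal_form (hφ : 0 < Real.sin φ) (κ : ℝ) (α : ℂ)
    (hα : (α * (1 - Complex.exp (2 * Complex.I * φ))).im = 1 / (2 * β * Real.sin φ))
    (n : ℤ) (s : ℝ) :
    Filter.Tendsto (fun x =>
        (star (eigenvector a b β γ κ α (p x) n s 0) * eigenvector a b β γ κ α (p x) n s 0
          - star (eigenvector a b β γ κ α (p x) n s 1) * eigenvector a b β γ κ α (p x) n s 1)
          / (star (p x).1 - (p x).1)) F
      (nhds ((2 / β : ℂ) * ((1 + amp a b β γ φ κ n s * amp a b β γ φ κ n s)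
        / ((phaseW φ)⁻¹ - phaseW φ)))) := by
  have hβ' : (β : ℂ) ≠ 0 := by exact_mod_cast hβ.ne'
  have hE := halfPhase_ne_zero a b γ n s
  have hv := phaseW_ne_zero φ
  have hd := phaseW_inv_sub_ne_zero hφ hφ
  have hm : amp a b β γ φ κ n s ≠ 0 := Complex.exp_ne_zero _
  have he := tendsto_exp_omega hβ ht hs hr hc κ n s
  have hes := he.star
  have hei := he.inv₀ hm
  rw [star_amp] at hes
  have hesi := hes.inv₀ hm
  have hw := tendsto_curveW hβ ht
  have hws := hw.star
  rw [star_phaseW] at hws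
  have hwsi := hws.inv₀ (inv_ne_zero hv)
  have hwi := hw.inv₀ hv
  have hlim := ((((hes.mul he).mul ((hws.sub hw).inv₀ hd)).const_mul (2 / β : ℂ)).add
    ((((hes.mul hei).const_mul α).mul ((hwsi.mul hw).const_sub 1)).sub
      (((he.mul hesi).const_mul (star α)).mul ((hws.mul hwi).const_sub 1)))).sub
    ((((tendsto_lam_sub ht).const_mul (star α * α)).mul ((hws.mul hw).const_sub 1)).mul
      (hei.mul hesi))
  -- The cross terms add up to `2i Im(α (1 - e^{2iφ}))`; the prescribed imaginary part is the one
  -- for which they supply the `δ_ii` term of `G`.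
  have hα2 : α * (1 - phaseW φ * phaseW φ) - star α * (1 - (phaseW φ)⁻¹ * (phaseW φ)⁻¹)
      = (2 / β : ℂ) / ((phaseW φ)⁻¹ - phaseW φ) := by
    have h1 : Complex.exp (2 * Complex.I * φ) = phaseW φ * phaseW φ := by
      rw [phaseW, ← Complex.exp_add]
      ring_nf
    rw [h1] at hα
    have h2 : star (α * (1 - phaseW φ * phaseW φ))
        = star α * (1 - (phaseW φ)⁻¹ * (phaseW φ)⁻¹) := by
      rw [star_mul', star_sub, star_one, star_mul', star_phaseW]
    rw [← h2, Complex.star_def, Complex.sub_conj, hα, eq_div_iff hd]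
    have hsin : ((Real.sin φ : ℝ) : ℂ) ≠ 0 := by exact_mod_cast hφ.ne'
    have h3 : (phaseW φ)⁻¹ - phaseW φ = -(2 * Complex.I * (Real.sin φ : ℝ)) := by
      rw [sin_eq_phaseW]
      linear_combination ((phaseW φ)⁻¹ - phaseW φ) * Complex.I_sq
    rw [h3]
    push_cast at hsin ⊢
    field_simp
    linear_combination -Complex.I_sq
  have hval : (2 / β : ℂ) * (amp a b β γ φ κ n s * amp a b β γ φ κ n s * ((phaseW φ)⁻¹ - phaseW φ)⁻¹)
      + (α * (amp a b β γ φ κ n s * (amp a b β γ φ κ n s)⁻¹) * (1 - ((phaseW φ)⁻¹)⁻¹ * phaseW φ)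
        - star α * (amp a b β γ φ κ n s * (amp a b β γ φ κ n s)⁻¹)
          * (1 - (phaseW φ)⁻¹ * (phaseW φ)⁻¹))
      - star α * α * 0 * (1 - (phaseW φ)⁻¹ * phaseW φ)
        * ((amp a b β γ φ κ n s)⁻¹ * (amp a b β γ φ κ n s)⁻¹)
      = (2 / β : ℂ) * ((1 + amp a b β γ φ κ n s * amp a b β γ φ κ n s)
        / ((phaseW φ)⁻¹ - phaseW φ)) := by
    rw [mul_inv_cancel₀ hm, mul_one, mul_one, inv_inv, hα2]
    ring
  rw [hval] at hlim
  refine hlim.congr' ?_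
  filter_upwards [hc] with x hx
  have hδ : star (p x).1 - (p x).1 ≠ 0 := by
    intro h
    have h1 := Complex.conj_eq_iff_im.mp (sub_eq_zero.mp h)
    exact hx.2 h1
  have hw0 := curveW_ne_zero hβ hx
  have hw0s : star (curveW a b β γ (p x)) ≠ 0 := star_ne_zero.mpr hw0
  have hl := seedLam_curveW hβ hx
  have hls : star (p x).1 = β / 2 * (star (curveW a b β γ (p x)) + (star (curveW a b β γ (p x)))⁻¹)
      - seedC a b γ := by
    rw [← hl, seedLam, star_sub, star_mul', star_add, star_inv₀]
    simp
  have he0 := Complex.exp_ne_zero (omega a b γ κ (p x) n s)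
  have he0s : star (Complex.exp (omega a b γ κ (p x) n s)) ≠ 0 := star_ne_zero.mpr he0
  rw [eigenvector_zero, eigenvector_one hβ hx]
  simp only [star_mul', star_add, star_inv₀, star_halfPhase, star_sub, star_star, inv_inv]
  have hfac : star (p x).1 - (p x).1 = β / 2 * (star (curveW a b β γ (p x)) - curveW a b β γ (p x))
      * (1 - (star (curveW a b β γ (p x)))⁻¹ * (curveW a b β γ (p x))⁻¹) := by
    refine (congrArg₂ (· - ·) hls hl.symm).trans ?_
    rw [seedLam]
    field_simp
    ring
  have hVW : star (curveW a b β γ (p x)) - curveW a b β γ (p x) ≠ 0 := by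
    intro h
    rw [h, mul_zero, zero_mul] at hfac
    exact hδ hfac
  have hfirst : (2 / β : ℂ) * (star (curveW a b β γ (p x)) - curveW a b β γ (p x))⁻¹
      = (1 - (star (curveW a b β γ (p x)))⁻¹ * (curveW a b β γ (p x))⁻¹)
        / (star (p x).1 - (p x).1) := by
    rw [eq_div_iff hδ, hfac]
    field_simp
  have hneg : (p x).1 - star (p x).1 = -(star (p x).1 - (p x).1) := by ring
  rw [mul_left_comm, hfirst, hneg]
  generalize star (p x).1 - (p x).1 = δ at hδ
  generalize star (curveW a b β γ (p x)) = V at hw0s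
  generalize curveW a b β γ (p x) = W at hw0
  generalize star (Complex.exp (omega a b γ κ (p x) n s)) = e' at he0s
  generalize Complex.exp (omega a b γ κ (p x) n s) = e at he0
  field_simp
  ring

end SingleLimit

/-! ### The limit of the N-fold Darboux transformation -/

theorem tendsto_trace_adjugate_mul {X m n : Type*} [Fintype m] [Fintype n] [DecidableEq n]
    {F : Filter X} {M : X → Matrix n n ℂ} {Y : X → Matrix m n ℂ} {M₀ : Matrix n n ℂ}
    {Y₀ : Matrix m n ℂ} (c : ℂ) (hM : Filter.Tendsto M F (nhds M₀))
    (hY : Filter.Tendsto Y F (nhds Y₀)) :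
    Filter.Tendsto (fun x => ((M x).adjugate * (c • ((Y x)ᴴ * Y x))).trace) F
      (nhds (M₀.adjugate * (c • (Y₀ᴴ * Y₀))).trace) := by
  have hadj : Filter.Tendsto (fun x => (M x).adjugate) F (nhds M₀.adjugate) :=
    ((continuous_id.matrix_adjugate).tendsto M₀).comp hM
  have hA : ∀ i j, Filter.Tendsto (fun x => (M x).adjugate i j) F (nhds (M₀.adjugate i j)) :=
    fun i j => tendsto_pi_nhds.mp (tendsto_pi_nhds.mp hadj i) j
  have hB : ∀ i j, Filter.Tendsto (fun x => Y x i j) F (nhds (Y₀ i j)) :=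
    fun i j => tendsto_pi_nhds.mp (tendsto_pi_nhds.mp hY i) j
  simp only [Matrix.trace, Matrix.diag_apply, Matrix.mul_apply, Matrix.smul_apply,
    Matrix.conjTranspose_apply, smul_eq_mul]
  exact tendsto_finsetSum _ fun i _ => tendsto_finsetSum _ fun j _ => (hA i j).mul
    ((tendsto_finsetSum _ fun k _ => (hB k j).star.mul (hB k i)).const_mul c)

section Family

variable {N : ℕ} {a b β γ : ℝ} {φ κ : Fin N → ℝ}

theorem toRealAxis_neBot (hβ : 0 < β) (hφ : ∀ i, 0 < Real.sin (φ i)) :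
    (toRealAxis a b β γ φ).NeBot := by
  have hβ' : (β : ℂ) ≠ 0 := by exact_mod_cast hβ.ne'
  -- The curve points with uniformizing parameters `w_i = r e^{iφ_i}`; for `r > 1` the imaginary
  -- part of `λ_i` is `(β/2) sin φ_i (r - 1/r) > 0`.
  set f : ℝ → Fin N → ℂ × ℂ := fun r i =>
    (seedLam a b β γ (phaseW (φ i) * r), β / 2 * (phaseW (φ i) * r - (phaseW (φ i) * r)⁻¹)) with hf
  have hcont : Filter.Tendsto f (nhds 1) (nhds fun i => realPoint a b β γ (φ i)) := by
    rw [tendsto_pi_nhds]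
    intro i
    have h1 : Filter.Tendsto (fun r : ℝ => phaseW (φ i) * r) (nhds 1) (nhds (phaseW (φ i))) := by
      have := (Complex.continuous_ofReal.tendsto 1).const_mul (phaseW (φ i))
      simpa using this
    have h2 := h1.inv₀ (phaseW_ne_zero (φ i))
    have h3 : realPoint a b β γ (φ i)
        = (β / 2 * (phaseW (φ i) + (phaseW (φ i))⁻¹) - seedC a b γ,
          β / 2 * (phaseW (φ i) - (phaseW (φ i))⁻¹)) := by
      rw [realPoint, Complex.ofReal_sub, Complex.ofReal_mul, Complex.ofReal_mul, cos_eq_phaseW,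
        sin_eq_phaseW]
      refine Prod.ext ?_ ?_
      · simp only
        ring
      · simp only
        linear_combination (-(β / 2) * (phaseW (φ i) - (phaseW (φ i))⁻¹)) * Complex.I_sq
    rw [h3]
    exact (((h1.add h2).const_mul (β / 2 : ℂ)).sub_const _).prodMk_nhds
      ((h1.sub h2).const_mul (β / 2 : ℂ))
  have hmem : ∀ᶠ r in nhdsWithin (1 : ℝ) (Set.Ioi 1), f r ∈
      {p : Fin N → ℂ × ℂ | ∀ i, p i ∈ spectralCurve a b β γ} := by
    filter_upwards [self_mem_nhdsWithin] with r hr1 i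
    have hr1' : (1 : ℝ) < r := hr1
    have hr0 : (r : ℂ) ≠ 0 := by exact_mod_cast (zero_lt_one.trans hr1').ne'
    have hw := phaseW_ne_zero (φ i)
    refine ⟨?_, ?_⟩
    · simp only [hf, seedLam]
      field_simp
      ring
    · have h1 : (f r i).1 = ((β / 2 * (Real.cos (φ i) * (r + r⁻¹)) - seedC a b γ : ℝ) : ℂ)
          + ((β / 2 * (Real.sin (φ i) * (r - r⁻¹)) : ℝ) : ℂ) * Complex.I := by
        simp only [hf, seedLam]
        push_cast [-Complex.ofReal_cos, -Complex.ofReal_sin]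
        rw [cos_eq_phaseW, sin_eq_phaseW]
        field_simp
        linear_combination ((β : ℂ) * (phaseW (φ i) ^ 2 - 1) * (r ^ 2 - 1)) * Complex.I_sq
      rw [h1, Complex.add_im, Complex.ofReal_im, Complex.im_ofReal_mul, Complex.I_im, mul_one,
        zero_add]
      have hs := hφ i
      have h2 : r⁻¹ < r := (inv_lt_one_of_one_lt₀ hr1').trans hr1'
      have h3 : 0 < r - r⁻¹ := sub_pos.mpr h2
      positivity
  have h : Filter.Tendsto f (nhdsWithin 1 (Set.Ioi 1)) (toRealAxis a b β γ φ) :=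
    tendsto_nhdsWithin_iff.mpr ⟨hcont.mono_left nhdsWithin_le_nhds, hmem⟩
  exact h.neBot

theorem tendsto_eval_toRealAxis (i : Fin N) :
    Filter.Tendsto (fun p : Fin N → ℂ × ℂ => p i) (toRealAxis a b β γ φ)
      (nhds (realPoint a b β γ (φ i))) :=
  ((continuous_apply i).tendsto _).mono_left nhdsWithin_le_nhds

theorem eventually_mem_spectralCurve :
    ∀ᶠ p in toRealAxis a b β γ φ, ∀ i, p i ∈ spectralCurve a b β γ :=
  self_mem_nhdsWithin

/-- The eigenvectors as columns of a matrix. -/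
def eigenMatrix (a b β γ : ℝ) (κ : Fin N → ℝ) (α : Fin N → ℂ) (p : Fin N → ℂ × ℂ) (n : ℤ)
    (s : ℝ) : Matrix (Fin 2) (Fin N) ℂ :=
  Matrix.of fun r j => eigenvector a b β γ (κ j) (α j) (p j) n s r

/-- The matrix `M_n` of the Darboux transformation of the plane wave. -/
abbrev seedM (a b β γ : ℝ) (κ : Fin N → ℝ) (α : Fin N → ℂ) (p : Fin N → ℂ × ℂ) (n : ℤ)
    (s : ℝ) : Matrix (Fin N) (Fin N) ℂ :=
  dtM (-1) (fun i => (p i).1) (fun i => eigenvector a b β γ (κ i) (α i) (p i)) n s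

theorem seedM_apply (α : Fin N → ℂ) (p : Fin N → ℂ × ℂ) (n : ℤ) (s : ℝ) (i j : Fin N) :
    seedM a b β γ κ α p n s i j
      = (star (eigenvector a b β γ (κ i) (α i) (p i) n s 0)
          * eigenvector a b β γ (κ j) (α j) (p j) n s 0
        - star (eigenvector a b β γ (κ i) (α i) (p i) n s 1)
          * eigenvector a b β γ (κ j) (α j) (p j) n s 1) / (star (p i).1 - (p j).1) := by
  rw [seedM, dtM, Matrix.of_apply]
  congr 1
  simp [dotProduct, Fin.sum_univ_two, Matrix.mulVec_diagonal]
  ring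

/-- `V(λ_i)† J + J V(λ_j) = -(i/4) (conj λ_i - λ_j)`, so differentiation cancels the denominator and
the derivative stays bounded as the parameters become real. -/
theorem hasEntryDerivAt_seedM (hβ : 0 < β) (α : Fin N → ℂ) {p : Fin N → ℂ × ℂ}
    (hp : ∀ i, p i ∈ spectralCurve a b β γ) (hne : ∀ i j, star (p i).1 - (p j).1 ≠ 0)
    (n : ℤ) (s : ℝ) :
    HasEntryDerivAt (seedM a b β γ κ α p n)
      (-(Complex.I / 4) • ((eigenMatrix a b β γ κ α p n s)ᴴ * eigenMatrix a b β γ κ α p n s)) s := by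
  intro i j
  have h : ∀ i r, HasDerivAt (fun u => eigenvector a b β γ (κ i) (α i) (p i) n u r) _ s :=
    fun i r => (hasDerivAt_pi.mp (hasDerivAt_eigenvector hβ (hp i) (κ i) (α i) n s)) r
  have h1 := ((((h i 0).star.mul (h j 0)).sub ((h i 1).star.mul (h j 1)))).div_const
    (star (p i).1 - (p j).1)
  simp only [seedM_apply]
  refine h1.congr_deriv ?_
  rw [div_eq_iff (hne i j), Matrix.smul_apply, Matrix.mul_apply, Fin.sum_univ_two,
    Matrix.conjTranspose_apply, Matrix.conjTranspose_apply]
  simp only [eigenMatrix, Matrix.of_apply, Matrix.mulVec, dotProduct, Fin.sum_univ_two, laxV,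
    Matrix.cons_val_zero, Matrix.cons_val_one, Matrix.cons_val', Matrix.cons_val_fin_one, star_add,
    star_mul', star_neg, star_div₀, smul_eq_mul, Complex.star_def, Complex.conj_I,
    Complex.conj_ofNat, Complex.conj_ofReal, Complex.conj_conj]
  push_cast
  ring

/-! ### Convergence of `M_n` and of the transformed fields -/

section Limits

variable (hβ : 0 < β) (hs : Real.sin (b / 2) ≠ 0) (hφ : ∀ i, 0 < φ i ∧ φ i < Real.pi)
  (hr : ∀ i, 0 < growthRatio a b β γ (φ i))
include hβ hs hr in
theorem tendsto_eigenMatrix (α : Fin N → ℂ) (n : ℤ) (s : ℝ) :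
    Filter.Tendsto (fun p => eigenMatrix a b β γ κ α p n s) (toRealAxis a b β γ φ)
      (nhds (darkY a b β γ φ κ n s)) := by
  refine tendsto_pi_nhds.mpr fun r => tendsto_pi_nhds.mpr fun j => ?_
  have ht := tendsto_eval_toRealAxis (a := a) (b := b) (β := β) (γ := γ) (φ := φ) j
  have hc := (eventually_mem_spectralCurve (a := a) (b := b) (β := β) (γ := γ) (φ := φ)).mono
    fun p hp => hp j
  fin_cases r
  · exact tendsto_eigenvector_zero hβ ht hs (hr j) hc (κ j) (α j) n s
  · exact tendsto_eigenvector_one hβ ht hs (hr j) hc (κ j) (α j) n s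

include hβ hφ

theorem seedLam_phaseW_sub_ne_zero (hinj : Function.Injective φ) {i j : Fin N} (hij : i ≠ j) :
    seedLam a b β γ (phaseW (φ i)) - seedLam a b β γ (phaseW (φ j)) ≠ 0 := by
  rw [seedLam_phaseW, seedLam_phaseW, ← Complex.ofReal_sub, Complex.ofReal_ne_zero,
    sub_sub_sub_cancel_right, ← mul_sub]
  refine mul_ne_zero hβ.ne' (sub_ne_zero.mpr fun h => hij (hinj ?_))
  exact Real.injOn_cos ⟨(hφ i).1.le, (hφ i).2.le⟩ ⟨(hφ j).1.le, (hφ j).2.le⟩ h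

theorem eventually_star_lam_sub_ne_zero (hinj : Function.Injective φ) :
    ∀ᶠ p in toRealAxis a b β γ φ, ∀ i j, star (p i).1 - (p j).1 ≠ 0 := by
  rw [Filter.eventually_all]
  intro i
  rw [Filter.eventually_all]
  intro j
  by_cases hij : i = j
  · subst hij
    filter_upwards [eventually_mem_spectralCurve] with p hp h
    exact (hp i).2 (Complex.conj_eq_iff_im.mp (sub_eq_zero.mp h))
  · exact ((tendsto_star_lam (tendsto_eval_toRealAxis i)).sub
      (tendsto_lam (tendsto_eval_toRealAxis j))).eventually_ne
        (seedLam_phaseW_sub_ne_zero hβ hφ hinj hij)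

theorem det_smul_darkG_ne_zero (n : ℤ) (s : ℝ) :
    ((2 / β : ℂ) • darkG a b β γ φ κ n s).det ≠ 0 := by
  have hβ' : (β : ℂ) ≠ 0 := by exact_mod_cast hβ.ne'
  rw [Matrix.det_smul]
  exact mul_ne_zero (pow_ne_zero _ (div_ne_zero two_ne_zero hβ'))
    (darkG_det_ne_zero a b β γ φ κ
      (fun i => Real.sin_pos_of_pos_of_lt_pi (hφ i).1 (hφ i).2) n s)

include hs hr

variable (hinj : Function.Injective φ) (α : Fin N → ℂ)
  (hα : ∀ i, (α i * (1 - Complex.exp (2 * Complex.I * φ i))).im = 1 / (2 * β * Real.sin (φ i)))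
include hinj hα

theorem tendsto_seedM (n : ℤ) (s : ℝ) :
    Filter.Tendsto (fun p => seedM a b β γ κ α p n s) (toRealAxis a b β γ φ)
      (nhds ((2 / β : ℂ) • darkG a b β γ φ κ n s)) := by
  have hβ' : (β : ℂ) ≠ 0 := by exact_mod_cast hβ.ne'
  have hsin : ∀ i, 0 < Real.sin (φ i) := fun i => Real.sin_pos_of_pos_of_lt_pi (hφ i).1 (hφ i).2
  refine tendsto_pi_nhds.mpr fun i => tendsto_pi_nhds.mpr fun j => ?_
  have ht := tendsto_eval_toRealAxis (a := a) (b := b) (β := β) (γ := γ) (φ := φ)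
  have hc : ∀ i, ∀ᶠ p in toRealAxis a b β γ φ, p i ∈ spectralCurve a b β γ := fun i =>
    eventually_mem_spectralCurve.mono fun p hp => hp i
  simp only [seedM_apply]
  rw [Matrix.smul_apply, smul_eq_mul]
  by_cases hij : i = j
  · subst hij
    rw [darkG_apply, if_pos rfl]
    exact tendsto_diagonal_form hβ (ht i) hs (hr i) (hc i) (hsin i) (κ i) (α i) (hα i) n s
  · have hne := seedLam_phaseW_sub_ne_zero (a := a) (b := b) (γ := γ) hβ hφ hinj hij
    have hY := tendsto_eigenMatrix (κ := κ) hβ hs hr α n s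
    have hent : ∀ r j, Filter.Tendsto (fun p : Fin N → ℂ × ℂ =>
        eigenvector a b β γ (κ j) (α j) (p j) n s r) (toRealAxis a b β γ φ)
        (nhds (darkY a b β γ φ κ n s r j)) := fun r j =>
      tendsto_pi_nhds.mp (tendsto_pi_nhds.mp hY r) j
    have hlim := (((hent 0 i).star.mul (hent 0 j)).sub ((hent 1 i).star.mul (hent 1 j))).div
      ((tendsto_star_lam (ht i)).sub (tendsto_lam (ht j))) hne
    -- For `λ_i ≠ λ_j` the Sylvester relation can be solved for the entry of `G`.
    have hval := congrFun (congrFun (darkL_commutator a b β γ φ κ hsin n s) i) j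
    rw [Matrix.sub_apply, darkL, Matrix.diagonal_mul, Matrix.mul_diagonal, Matrix.smul_apply,
      Matrix.mul_apply, Fin.sum_univ_two, Matrix.mul_apply, Matrix.mul_apply, Fin.sum_univ_two,
      Fin.sum_univ_two] at hval
    simp only [sigJ, Matrix.conjTranspose_apply, Matrix.of_apply, Matrix.cons_val_zero,
      Matrix.cons_val_one, Matrix.cons_val', Matrix.cons_val_fin_one, smul_eq_mul] at hval
    have hval' : (star (darkY a b β γ φ κ n s 0 i) * darkY a b β γ φ κ n s 0 j
        - star (darkY a b β γ φ κ n s 1 i) * darkY a b β γ φ κ n s 1 j)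
        / (seedLam a b β γ (phaseW (φ i)) - seedLam a b β γ (phaseW (φ j)))
        = 2 / β * darkG a b β γ φ κ n s i j := by
      rw [div_eq_iff hne]
      field_simp
      linear_combination (-2) * hval
    rw [hval'] at hlim
    exact hlim

theorem tendsto_det_seedM (n : ℤ) (s : ℝ) :
    Filter.Tendsto (fun p => (seedM a b β γ κ α p n s).det) (toRealAxis a b β γ φ)
      (nhds ((2 / β : ℂ) • darkG a b β γ φ κ n s).det) :=
  ((continuous_id.matrix_det).tendsto _).comp (tendsto_seedM hβ hs hφ hr hinj α hα n s)

theorem eventually_det_seedM_ne_zero (n : ℤ) (s : ℝ) :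
    ∀ᶠ p in toRealAxis a b β γ φ, (seedM a b β γ κ α p n s).det ≠ 0 :=
  (tendsto_det_seedM hβ hs hφ hr hinj α hα n s).eventually_ne
    (det_smul_darkG_ne_zero (a := a) (b := b) (γ := γ) (κ := κ) hβ hφ n s)

/-- No interchange of limit and derivative is needed: by Jacobi's formula the logarithmic derivative
is a continuous function of `M` and the eigenvectors. The factor `(2/β)^N` in `det M → (2/β)^N det
G` drops out. -/
theorem tendsto_logDeriv_det_seedM (n : ℤ) (s : ℝ) :
    Filter.Tendsto (fun p => logDeriv (fun u => (seedM a b β γ κ α p n u).det) s)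
      (toRealAxis a b β γ φ) (nhds (logDeriv (fun u => (darkG a b β γ φ κ n u).det) s)) := by
  have hβ' : (β : ℂ) ≠ 0 := by exact_mod_cast hβ.ne'
  have hsin : ∀ i, 0 < Real.sin (φ i) := fun i => Real.sin_pos_of_pos_of_lt_pi (hφ i).1 (hφ i).2
  have hM := tendsto_seedM (κ := κ) hβ hs hφ hr hinj α hα n s
  have hY := tendsto_eigenMatrix (κ := κ) hβ hs hr α n s
  have hlim := (tendsto_trace_adjugate_mul (-(Complex.I / 4)) hM hY).div
    (tendsto_det_seedM (κ := κ) hβ hs hφ hr hinj α hα n s)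
    (det_smul_darkG_ne_zero (a := a) (b := b) (γ := γ) (κ := κ) hβ hφ n s)
  have hG : HasEntryDerivAt (fun u => (2 / β : ℂ) • darkG a b β γ φ κ n u)
      (-(Complex.I / 4) • ((darkY a b β γ φ κ n s)ᴴ * darkY a b β γ φ κ n s)) s := by
    refine ((hasEntryDerivAt_darkG a b β γ φ κ hsin n s).const_smul (2 / β : ℂ)).congr_deriv ?_
    rw [smul_smul]
    congr 1
    field_simp
  have hval := hG.logDeriv_det
  have hconst : logDeriv (fun u => ((2 / β : ℂ) • darkG a b β γ φ κ n u).det) s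
      = logDeriv (fun u => (darkG a b β γ φ κ n u).det) s := by
    simp only [Matrix.det_smul]
    exact logDeriv_const_mul s _ (pow_ne_zero _ (div_ne_zero two_ne_zero hβ'))
  rw [← hconst, hval]
  refine hlim.congr' ?_
  filter_upwards [eventually_mem_spectralCurve,
    eventually_star_lam_sub_ne_zero (a := a) (b := b) (γ := γ) hβ hφ hinj] with p hp hne
  exact (hasEntryDerivAt_seedM hβ α hp hne n s).logDeriv_det.symm

theorem tendsto_logDeriv_det_seedM_div (n : ℤ) (s : ℝ) :
    Filter.Tendsto (fun p => logDeriv (fun u =>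
        (seedM a b β γ κ α p (n + 1) u).det / (seedM a b β γ κ α p n u).det) s)
      (toRealAxis a b β γ φ) (nhds (logDeriv (fun u =>
        (darkG a b β γ φ κ (n + 1) u).det / (darkG a b β γ φ κ n u).det) s)) := by
  have hsin : ∀ i, 0 < Real.sin (φ i) := fun i => Real.sin_pos_of_pos_of_lt_pi (hφ i).1 (hφ i).2
  rw [logDeriv_div s (darkG_det_ne_zero a b β γ φ κ hsin (n + 1) s)
    (darkG_det_ne_zero a b β γ φ κ hsin n s) (darkG_det_differentiableAt a b β γ φ κ hsin (n + 1) s)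
    (darkG_det_differentiableAt a b β γ φ κ hsin n s)]
  refine ((tendsto_logDeriv_det_seedM hβ hs hφ hr hinj α hα (n + 1) s).sub
    (tendsto_logDeriv_det_seedM hβ hs hφ hr hinj α hα n s)).congr' ?_
  filter_upwards [eventually_mem_spectralCurve,
    eventually_star_lam_sub_ne_zero (a := a) (b := b) (γ := γ) hβ hφ hinj,
    eventually_det_seedM_ne_zero (κ := κ) hβ hs hφ hr hinj α hα (n + 1) s,
    eventually_det_seedM_ne_zero (κ := κ) hβ hs hφ hr hinj α hα n s] with p hp hne h1 h2
  exact (logDeriv_div s h1 h2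
    (hasEntryDerivAt_seedM hβ α hp hne (n + 1) s).det.differentiableAt
    (hasEntryDerivAt_seedM hβ α hp hne n s).det.differentiableAt).symm

/-- The bordered determinant over `det M` is a Schur complement, tending to `(β/2) (Y G⁻¹ Y†)₁₀ =
W₁₀`; the sign of the Schur complement cancels that of `-Y_2`. -/
theorem tendsto_dtQ (n : ℤ) (s : ℝ) :
    Filter.Tendsto (fun p : Fin N → ℂ × ℂ => dtQ (-1) (seedQ a b β γ) (fun i => (p i).1)
        (fun i => eigenvector a b β γ (κ i) (α i) (p i)) n s)
      (toRealAxis a b β γ φ) (nhds (darkQ a b β γ φ κ n s)) := by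
  have hβ' : (β : ℂ) ≠ 0 := by exact_mod_cast hβ.ne'
  have hsin : ∀ i, 0 < Real.sin (φ i) := fun i => Real.sin_pos_of_pos_of_lt_pi (hφ i).1 (hφ i).2
  have hM := tendsto_seedM (κ := κ) hβ hs hφ hr hinj α hα n s
  have hY := tendsto_eigenMatrix (κ := κ) hβ hs hr α n s
  have hent : ∀ r j, Filter.Tendsto (fun p : Fin N → ℂ × ℂ =>
      eigenvector a b β γ (κ j) (α j) (p j) n s r) (toRealAxis a b β γ φ)
      (nhds (darkY a b β γ φ κ n s r j)) := fun r j =>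
    tendsto_pi_nhds.mp (tendsto_pi_nhds.mp hY r) j
  set B : Matrix (Fin N) Unit ℂ := Matrix.of fun i _ => star (darkY a b β γ φ κ n s 0 i) with hB
  set C : Matrix Unit (Fin N) ℂ := Matrix.of fun _ j => -darkY a b β γ φ κ n s 1 j with hC
  have hblock : Filter.Tendsto (fun p : Fin N → ℂ × ℂ => dtBordered (-1) (fun i => (p i).1)
      (fun i => eigenvector a b β γ (κ i) (α i) (p i)) n s) (toRealAxis a b β γ φ)
      (nhds (Matrix.fromBlocks ((2 / β : ℂ) • darkG a b β γ φ κ n s) B C 0)) := by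
    refine tendsto_pi_nhds.mpr fun i => tendsto_pi_nhds.mpr fun j => ?_
    rcases i with i | i <;> rcases j with j | j
    · exact tendsto_pi_nhds.mp (tendsto_pi_nhds.mp hM i) j
    · exact (hent 0 i).star
    · exact (hent 1 j).neg
    · exact tendsto_const_nhds
  have hG := det_smul_darkG_ne_zero (a := a) (b := b) (γ := γ) (κ := κ) hβ hφ n s
  have hdet := ((continuous_id.matrix_det).tendsto _).comp hblock
  have hlim := (hdet.div (tendsto_det_seedM hβ hs hφ hr hinj α hα n s) hG).const_add
    (seedQ a b β γ n s)
  have hinv : ((2 / β : ℂ) • darkG a b β γ φ κ n s)⁻¹ = (β / 2 : ℂ) • (darkG a b β γ φ κ n s)⁻¹ := by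
    refine Matrix.inv_eq_right_inv ?_
    rw [Matrix.smul_mul, Matrix.mul_smul, smul_smul,
      Matrix.mul_nonsing_inv _ (darkG_det_ne_zero a b β γ φ κ hsin n s).isUnit,
      div_mul_div_cancel₀ hβ', div_self two_ne_zero, one_smul]
  have hval : seedQ a b β γ n s
      + (Matrix.fromBlocks ((2 / β : ℂ) • darkG a b β γ φ κ n s) B C 0).det
        / ((2 / β : ℂ) • darkG a b β γ φ κ n s).det = darkQ a b β γ φ κ n s := by
    rw [det_bordered _ _ _ hG, neg_div, mul_div_cancel_left₀ _ hG, hinv,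
      darkQ_eq _ _ _ _ _ _ hsin, darkW_apply_zero, Matrix.mul_smul, Matrix.smul_mul,
      Matrix.smul_apply, smul_eq_mul, ← mul_neg]
    congr 2
    simp only [Matrix.mul_apply, hB, hC, Matrix.of_apply, Matrix.conjTranspose_apply, neg_mul,
      Finset.sum_neg_distrib, neg_neg]
  have hlim' : Filter.Tendsto (fun p : Fin N → ℂ × ℂ => dtQ (-1) (seedQ a b β γ) (fun i => (p i).1)
        (fun i => eigenvector a b β γ (κ i) (α i) (p i)) n s)
      (toRealAxis a b β γ φ) (nhds (seedQ a b β γ n s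
      + (Matrix.fromBlocks ((2 / β : ℂ) • darkG a b β γ φ κ n s) B C 0).det
        / ((2 / β : ℂ) • darkG a b β γ φ κ n s).det)) := hlim
  rwa [hval] at hlim'

end Limits

end Family

theorem sin_half_ne_zero {b : ℝ} (hb : ∀ k : ℤ, b ≠ k * Real.pi) : Real.sin (b / 2) ≠ 0 := by
  intro h
  obtain ⟨k, hk⟩ := Real.sin_eq_zero_iff.mp h
  refine hb (2 * k) ?_
  push_cast
  linear_combination (-2) * hk

end SemiDiscreteCSP

end

/-! ### Assembly -/

theorem proposition3 (N : ℕ) (a b β γ : ℝ) (ha : a ≠ 0) (hb : ∀ k : ℤ, b ≠ k * Real.pi)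
    (hβ : 0 ≤ β) (hγ : 0 < γ) (φ κ : Fin N → ℝ)
    (hφ : ∀ i, 0 < φ i ∧ φ i < Real.pi)
    (hratio : ∀ i, 0 < SemiDiscreteCSP.growthRatio a b β γ (φ i)) :
    ∃ ρ x : ℤ → ℝ → ℝ,
      -- the parametric formulas, which are well defined and real-valued
      (∀ n s,
        (SemiDiscreteCSP.darkG a b β γ φ κ n s).det ≠ 0 ∧
        (ρ n s : ℂ) = γ / 2 - 2 / a *
          logDeriv (fun u => (SemiDiscreteCSP.darkG a b β γ φ κ (n + 1) u).det
            / (SemiDiscreteCSP.darkG a b β γ φ κ n u).det) s ∧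
        (x n s : ℂ) = γ / 2 * a * n + β ^ 2 / 8 * s
          - 2 * logDeriv (fun u => (SemiDiscreteCSP.darkG a b β γ φ κ n u).det) s) ∧
      -- hodograph relations and the defocusing semi-discrete CSP equation, in `s` and in `t = -s`
      (∀ n s, a * ρ n s = x (n + 1) s - x n s) ∧
      (∀ n s, HasDerivAt (x n) (‖SemiDiscreteCSP.darkQ a b β γ φ κ n s‖ ^ 2 / 2) s) ∧
      SemiDiscreteCSP.IsCoupledSolution (-1) (SemiDiscreteCSP.darkQ a b β γ φ κ) x ∧
      SemiDiscreteCSP.SatisfiesScalarEquation (-1)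
        (fun n t => SemiDiscreteCSP.darkQ a b β γ φ κ n (-t)) (fun n t => x n (-t)) ∧
      -- the solution is the limit of the N-fold Darboux transformation of the plane-wave seed
      -- as the non-real spectral parameters tend to the real points `β cos φ_i - c`
      (0 < β → Function.Injective φ → ∀ α : Fin N → ℂ,
        (∀ i, (α i * (1 - Complex.exp (2 * Complex.I * φ i))).im
          = 1 / (2 * β * Real.sin (φ i))) →
        (SemiDiscreteCSP.toRealAxis a b β γ φ).NeBot ∧
          (∀ᶠ p in SemiDiscreteCSP.toRealAxis a b β γ φ, ∀ i, ∃ f : ℤ → ℂ, (∀ n, f n ≠ 0) ∧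
            SemiDiscreteCSP.IsLaxSolution (-1) a (SemiDiscreteCSP.seedQ a b β γ)
              (SemiDiscreteCSP.seedRho γ) (p i).1
              (fun n s => f n • SemiDiscreteCSP.eigenvector a b β γ (κ i) (α i) (p i) n s)) ∧
          ∀ n s,
            (∀ᶠ p in SemiDiscreteCSP.toRealAxis a b β γ φ,
              (SemiDiscreteCSP.dtM (-1) (fun i => (p i).1)
                (fun i => SemiDiscreteCSP.eigenvector a b β γ (κ i) (α i) (p i)) n s).det ≠ 0) ∧
            Filter.Tendsto (fun p : Fin N → ℂ × ℂ =>
                SemiDiscreteCSP.dtQ (-1) (SemiDiscreteCSP.seedQ a b β γ) (fun i => (p i).1)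
                  (fun i => SemiDiscreteCSP.eigenvector a b β γ (κ i) (α i) (p i)) n s)
              (SemiDiscreteCSP.toRealAxis a b β γ φ) (nhds (SemiDiscreteCSP.darkQ a b β γ φ κ n s)) ∧
            Filter.Tendsto (fun p : Fin N → ℂ × ℂ =>
                SemiDiscreteCSP.dtRho (-1) a (SemiDiscreteCSP.seedRho γ) (fun i => (p i).1)
                  (fun i => SemiDiscreteCSP.eigenvector a b β γ (κ i) (α i) (p i)) n s)
              (SemiDiscreteCSP.toRealAxis a b β γ φ) (nhds (ρ n s : ℂ)) ∧
            Filter.Tendsto (fun p : Fin N → ℂ × ℂ =>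
                SemiDiscreteCSP.dtX (-1) (SemiDiscreteCSP.seedX a β γ) (fun i => (p i).1)
                  (fun i => SemiDiscreteCSP.eigenvector a b β γ (κ i) (α i) (p i)) n s)
              (SemiDiscreteCSP.toRealAxis a b β γ φ) (nhds (x n s : ℂ))) := by
  have hs := SemiDiscreteCSP.sin_half_ne_zero hb
  have hsin : ∀ i, 0 < Real.sin (φ i) := fun i => Real.sin_pos_of_pos_of_lt_pi (hφ i).1 (hφ i).2
  have ha' : (a : ℂ) ≠ 0 := by exact_mod_cast ha
  set x := SemiDiscreteCSP.darkX a b β γ φ κ with hx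
  have hxeq : ∀ n s, (x n s : ℂ) = γ / 2 * a * n + β ^ 2 / 8 * s
      - 2 * logDeriv (fun u => (SemiDiscreteCSP.darkG a b β γ φ κ n u).det) s := by
    intro n s
    rw [hx, SemiDiscreteCSP.darkX_ofReal _ _ _ _ _ _ hsin,
      SemiDiscreteCSP.logDeriv_darkG_det _ _ _ _ _ _ hsin]
    ring
  have hρeq : ∀ n s, (((x (n + 1) s - x n s) / a : ℝ) : ℂ) = γ / 2 - 2 / a *
      logDeriv (fun u => (SemiDiscreteCSP.darkG a b β γ φ κ (n + 1) u).det
        / (SemiDiscreteCSP.darkG a b β γ φ κ n u).det) s := by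
    intro n s
    rw [Complex.ofReal_div, Complex.ofReal_sub, hx, SemiDiscreteCSP.darkX_ofReal _ _ _ _ _ _ hsin,
      SemiDiscreteCSP.darkX_ofReal _ _ _ _ _ _ hsin,
      SemiDiscreteCSP.logDeriv_darkG_det_div _ _ _ _ _ _ hsin]
    push_cast
    field_simp
    ring
  have hxd := SemiDiscreteCSP.hasDerivAt_darkX a b β γ φ κ hsin
  have hcoupled : SemiDiscreteCSP.IsCoupledSolution (-1) (SemiDiscreteCSP.darkQ a b β γ φ κ) x := by
    refine ⟨fun n s => ?_, fun n s => (hxd n s).differentiableAt, fun n s => ⟨?_, ?_⟩⟩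
    · have h : SemiDiscreteCSP.darkQ a b β γ φ κ n = fun u => SemiDiscreteCSP.seedQ a b β γ n u
          + SemiDiscreteCSP.darkW a b β γ φ κ n u 1 0 :=
        funext fun u => SemiDiscreteCSP.darkQ_eq a b β γ φ κ hsin n u
      rw [h]
      exact ((SemiDiscreteCSP.hasDerivAt_seedQ a b β γ n s).add
        (SemiDiscreteCSP.hasEntryDerivAt_darkW a b β γ φ κ hsin n s 1 0)).differentiableAt
    · exact (SemiDiscreteCSP.hasDerivAt_darkQ_sub a b β γ φ κ hsin hs hratio n s).deriv
    · have h : deriv (fun u => x (n + 1) u - x n u) s = _ := ((hxd (n + 1) s).sub (hxd n s)).deriv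
      rw [h]
      ring
  -- Defining `ρ` through the hodograph relation makes its reality evident; `hρeq` recovers the
  -- determinant formula.
  refine ⟨fun n s => (x (n + 1) s - x n s) / a, x, fun n s =>
    ⟨SemiDiscreteCSP.darkG_det_ne_zero a b β γ φ κ hsin n s, hρeq n s, hxeq n s⟩,
    fun n s => mul_div_cancel₀ _ ha, hxd, hcoupled, hcoupled.satisfiesScalarEquation hxd,
    fun hβ0 hinj α hα => ⟨SemiDiscreteCSP.toRealAxis_neBot hβ0 hsin, ?_, fun n s =>
      ⟨SemiDiscreteCSP.eventually_det_seedM_ne_zero hβ0 hs hφ hratio hinj α hα n s,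
      SemiDiscreteCSP.tendsto_dtQ hβ0 hs hφ hratio hinj α hα n s, ?_, ?_⟩⟩⟩
  · rw [Filter.eventually_all]
    exact fun i => SemiDiscreteCSP.eventually_exists_isLaxSolution hβ0
      (SemiDiscreteCSP.tendsto_eval_toRealAxis i) hs (hratio i)
      (SemiDiscreteCSP.eventually_mem_spectralCurve.mono fun p hp => hp i) (κ i) (α i)
  · beta_reduce
    rw [hρeq]
    have h := ((SemiDiscreteCSP.tendsto_logDeriv_det_seedM_div (κ := κ) hβ0 hs hφ hratio hinj α hα
      n s).const_mul (2 / a : ℂ)).const_sub (γ / 2 : ℂ)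
    simpa only [SemiDiscreteCSP.dtRho, SemiDiscreteCSP.seedRho, Complex.ofReal_div,
      Complex.ofReal_ofNat] using h
  · rw [hxeq]
    have h := ((SemiDiscreteCSP.tendsto_logDeriv_det_seedM (κ := κ) hβ0 hs hφ hratio hinj α hα
      n s).const_mul 2).const_sub (γ / 2 * a * n + β ^ 2 / 8 * s : ℂ)
    simpa only [SemiDiscreteCSP.dtX, SemiDiscreteCSP.seedX, Complex.ofReal_add, Complex.ofReal_mul,
      Complex.ofReal_pow, Complex.ofReal_div, Complex.ofReal_ofNat, Complex.ofReal_intCast] using h
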